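/- Let $\mathcal{A}$ be an abelian length category, that is, an abelian category in which every object has a composition series. All subcategories are full, closed under isomorphisms, and contain the zero objects. A torsion class in $\mathcal{A}$ is a subcategory closed under extensions and quotients; let $L=\mathsf{tors}\,\mathcal{A}$ be the complete lattice of torsion classes ordered by inclusion. A torsion heart is a subcategory of the form $\mathcal{T}\cap\mathcal{U}^{\perp}$ for torsion classes $\mathcal{U}\subseteq\mathcal{T}$, where $\mathcal{U}^{\perp}=\{M\mid \operatorname{Hom}_{\mathcal{A}}(U,M)=0 \text{ for all } U\in\mathcal{U}\}$; a wide subcategory is one closed under extensions, kernels and cokernels; an ICE-closed subcategory is one closed under images, cokernels and extensions. Write $\mathsf{theart}\,\mathcal{A}$, $\mathsf{wide}\,\mathcal{A}$ and $\mathsf{ice}\,\mathcal{A}$ for the posets of torsion hearts, wide subcategories and ICE-closed subcategories, ordered by inclusion. For a complete lattice $K$, an element $j\in K$ is completely join-irreducible if $j=\bigvee X$ with $X\subseteq K$ implies $j\in X$; let $\operatorname{jirr}K$ be the set of such elements, put $j_*=\bigvee\{x\in K\mid x<j\}$ and $\kappa(j)=\max\{x\in K\mid j\wedge x=j_*\}$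 when this maximum exists. For $a\le b$ in $K$ put $$\operatorname{jlabel}[a,b]=\{j\in\operatorname{jirr}K\mid j\le b \text{ and } \kappa(j)\ge a\}.$$ The interval $[a,b]$ is a wide interval if $b=a\vee\bigvee\{a'\in K\mid a' \text{ covers } a,\ a'\le b\}$, and an ICE interval if $b\le a\vee\bigvee\{a'\in K\mid a'\text{ covers }a\}$. Then for $L=\mathsf{tors}\,\mathcal{A}$ the maximum defining $\kappa(j)$ exists for every $j\in\operatorname{jirr}L$, and there are isomorphisms of posets (1) $\{\operatorname{jlabel}[a,b]\mid [a,b]\text{ an interval of }L\}\cong\mathsf{theart}\,\mathcal{A}$, (2) $\{\operatorname{jlabel}[a,b]\mid [a,b]\text{ a wide interval of }L\}\cong\mathsf{wide}\,\mathcal{A}$, (3) $\{\operatorname{jlabel}[a,b]\mid [a,b]\text{ an ICE interval of }L\}\cong\mathsf{ice}\,\mathcal{A}$, where the left-hand sides are ordered by inclusion. In particular, these three posets can be computed from the lattice structure of $L$ alone: the existence of $\kappa$ and the isomorphisms (1)–(3) hold for every complete lattice $L$ that is isomorphic to $\mathsf{tors}\,\mathcal{A}$. -/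

import Mathlib

open CategoryTheory CategoryTheory.Limits

universe w v u

section LatticeSide

variable (L : Type w) [CompleteLattice L]

/-- An element `j` of a complete lattice is completely join-irreducible if `j = ⋁ X` implies
`j ∈ X`, for every subset `X`. -/
def IsCompletelyJoinIrreducible {L : Type w} [CompleteLattice L] (j : L) : Prop :=
  ∀ X : Set L, j = sSup X → j ∈ X

/-- The set `jirr L` of completely join-irreducible elements, as a type. -/
abbrev JIrr : Type w := {j : L // IsCompletelyJoinIrreducible j}

variable {L}

/-- `a_* = ⋁ {x | x < a}`. -/
def lowerStar (a : L) : L := sSup {x : L | x < a}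

/-- The set `{x | j ∧ x = j_*}`, whose maximum is `κ(j)`. -/
def kappaSet (j : L) : Set L := {x : L | j ⊓ x = lowerStar j}

/-- The kappa map `κ(j) = max {x | j ∧ x = j_*}`. It is written as a supremum, which is the maximum
whenever a maximum exists (as it does in a completely semidistributive lattice). -/
def kappa (j : JIrr L) : L := sSup (kappaSet j.1)

/-- `jlabel [a, b] = {j ∈ jirr L | j ≤ b and κ(j) ≥ a}`. The type `NonemptyInterval L` is the type
of pairs `(a, b)` with `a ≤ b`. -/
def jlabel (I : NonemptyInterval L) : Set (JIrr L) := {j | j.1 ≤ I.snd ∧ I.fst ≤ kappa j}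

variable (L)

/-- The wide intervals `[a, b]`: those with `b = a ∨ ⋁ {a' | a' covers a and a' ≤ b}`. -/
def wideIntervals : Set (NonemptyInterval L) :=
  {I | I.snd = I.fst ⊔ sSup {a' : L | I.fst ⋖ a' ∧ a' ≤ I.snd}}

/-- The ICE intervals `[a, b]`: those with `b ≤ a ∨ ⋁ {a' | a' covers a}`. -/
def iceIntervals : Set (NonemptyInterval L) :=
  {I | I.snd ≤ I.fst ⊔ sSup {a' : L | I.fst ⋖ a'}}

variable {L}

/-- The image of a set of intervals under `jlabel`; as a type, it is a poset under inclusion. -/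
def jlabelImage (S : Set (NonemptyInterval L)) : Set (Set (JIrr L)) := jlabel '' S

end LatticeSide

section CategorySide

variable (C : Type u) [Category.{v} C] [Abelian C]

/-- An abelian length category: every object `X` has a composition series, that is, a finite chain
`0 = X₀ ⊂ X₁ ⊂ ⋯ ⊂ Xₙ = X` of subobjects in which each term is a maximal proper subobject of the
next one. -/
class IsLengthCategory : Prop where
  exists_compositionSeries (X : C) :
    ∃ s : RelSeries {p : Subobject X × Subobject X | p.1 ⋖ p.2}, s.head = ⊥ ∧ s.last = ⊤

variable {C}

/-- Torsion classes: (nonempty) subcategories closed under extensions and quotients. Closure under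
isomorphisms is automatic. -/
structure IsTorsionClass (P : ObjectProperty C) : Prop where
  containsZero : P.ContainsZero
  extensions : P.IsClosedUnderExtensions
  quotients : P.IsClosedUnderQuotients

/-- Closure under images of morphisms between objects of the subcategory. -/
def IsClosedUnderImages (P : ObjectProperty C) : Prop :=
  ∀ ⦃X Y : C⦄ (f : X ⟶ Y), P X → P Y → P (image f)

/-- Wide subcategories: (nonempty) subcategories closed under extensions, kernels and cokernels.
Closure under isomorphisms is automatic. -/
structure IsWideSubcategory (P : ObjectProperty C) : Prop where
  containsZero : P.ContainsZero
  extensions : P.IsClosedUnderExtensions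
  kernels : P.IsClosedUnderKernels
  cokernels : P.IsClosedUnderCokernels

/-- ICE-closed subcategories: (nonempty) subcategories closed under images, cokernels and
extensions. Closure under isomorphisms is automatic. -/
structure IsICEClosed (P : ObjectProperty C) : Prop where
  containsZero : P.ContainsZero
  images : IsClosedUnderImages P
  cokernels : P.IsClosedUnderCokernels
  extensions : P.IsClosedUnderExtensions

variable (C)

/-- The poset `tors C` of torsion classes, ordered by inclusion. -/
abbrev Tors : Type u := {P : ObjectProperty C // IsTorsionClass P}

/-- The poset of wide subcategories, ordered by inclusion. -/
abbrev Wide : Type u := {P : ObjectProperty C // IsWideSubcategory P}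

/-- The poset of ICE-closed subcategories, ordered by inclusion. -/
abbrev ICE : Type u := {P : ObjectProperty C // IsICEClosed P}

/-- Torsion classes are closed under arbitrary intersections. -/
instance torsInfSet : InfSet (Tors C) where
  sInf S :=
    ⟨fun X => ∀ T ∈ S, T.1 X,
      { containsZero := ⟨⟨_, isZero_zero C, fun T _ => by
          have := T.2.containsZero
          have := T.2.quotients
          exact T.1.prop_zero⟩⟩
        extensions := ⟨fun hS h₁ h₃ T hT => by
          have := T.2.extensions
          exact T.1.prop_X₂_of_shortExact hS (h₁ T hT) (h₃ T hT)⟩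
        quotients := ⟨fun f _ hX T hT => by
          have := T.2.quotients
          exact T.1.prop_of_epi f (hX T hT)⟩ }⟩

/-- `tors C` is a complete lattice for the inclusion order, with meets given by intersection. -/
instance torsCompleteLattice : CompleteLattice (Tors C) :=
  completeLatticeOfInf (Tors C) fun _ =>
    ⟨fun T hT _ hX => hX T hT, fun _ hU X hX _ hT => hU hT X hX⟩

variable {C}

/-- The heart `T ∩ U^⊥` of an interval `[U, T]` of torsion classes. -/
def heart (I : NonemptyInterval (Tors C)) : ObjectProperty C :=
  I.snd.1 ⊓ I.fst.1.rightOrthogonal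

variable (C)

/-- The poset of torsion hearts (the hearts of intervals of torsion classes), ordered by
inclusion. -/
abbrev THeart : Type u := {P : ObjectProperty C // ∃ I : NonemptyInterval (Tors C), heart I = P}

end CategorySide

/-! ### Length of objects via strictly monotone ranks on subobject lattices -/

section Length

/-! Completely join-irreducible torsion classes come from bricks. A brick B generates a torsion
class T(B) that is completely join-irreducible with κ(T(B)) = ⊥B, and every completely
join-irreducible is some T(B). Hence the label of [U, T] consists of the T(B) with B a brick in T ∩
U^⊥ (`mem_jlabel_iff`). A heart is built from its bricks by extensions (`prop_of_forall_brick`), so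
inclusion of labels is inclusion of hearts (`jlabel_subset_iff`), and any family of intervals has
isomorphic posets of labels and of hearts.

It remains to recognise the hearts of wide and ICE intervals. The tool is `Tors.rightWide`, the part
of U^⊥ whose maps into U^⊥ have cokernels in U^⊥. The covers of U are the classes U ∨ T(B), with B a
nonzero object there all of whose nonzero maps into U^⊥ are mono (`Tors.covBy_sup_objTors`,
`Tors.exists_rightWide_of_covBy`). Torsion-free objects in a join of covers are filtered by such B.
This puts the heart of an ICE interval inside `rightWide`, giving cokernels; if the covers lie below
T, the same filtration gives kernels.

Conversely, an ICE-closed P is the heart of [⊥P, ⊥P ∨ T(P)] (`IsICEClosed.heart_eq`) and lies in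
`rightWide` of ⊥P, so `Tors.le_sup_covers` bounds it by a join of covers; when P is wide, covers
below the upper end suffice.

All notions on the lattice side are order-theoretic, so they transport along any isomorphism L ≃
tors. -/

/-- A strictly monotone rank function extends along a cover in a modular lattice. -/
lemma exists_strictMonoOn_Iic_of_covBy {α : Type*} [Lattice α] [IsModularLattice α] {x y : α}
    (h : x ⋖ y) (hx : ∃ r : α → ℕ, StrictMonoOn r (Set.Iic x)) :
    ∃ r : α → ℕ, StrictMonoOn r (Set.Iic y) := by
  classical
  obtain ⟨r, hr⟩ := hx
  -- The summand 1 accounts for crossing the cover. If neither of p < q is below x, both have join y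
  -- with x, so modularity makes their meets with x differ.
  refine ⟨fun p => r (p ⊓ x) + if p ≤ x then 0 else 1, fun p hp q hq hpq => ?_⟩
  have hp' : p ≤ y := hp
  have hq' : q ≤ y := hq
  have hle : r (p ⊓ x) ≤ r (q ⊓ x) :=
    hr.monotoneOn inf_le_right inf_le_right (inf_le_inf_right x hpq.le)
  have hsup : ∀ z, z ≤ y → ¬ z ≤ x → z ⊔ x = y := fun z hz hzx => by
    rcases h.eq_or_eq le_sup_right (sup_le hz h.le) with h1 | h1
    · exact absurd (sup_eq_right.1 h1) hzx
    · exact h1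
  by_cases hqx : q ≤ x
  · have hpx : p ≤ x := hpq.le.trans hqx
    simp only [hpx, hqx, inf_eq_left.2, if_true, add_zero]
    exact hr hpx hqx hpq
  · by_cases hpx : p ≤ x
    · simp only [hpx, hqx, if_true, if_false]
      omega
    · simp only [hpx, hqx, if_false]
      have := hr (a := p ⊓ x) (b := q ⊓ x) inf_le_right inf_le_right
        (inf_lt_inf_of_lt_of_sup_le_sup hpq (by rw [hsup p hp' hpx, hsup q hq' hqx]))
      omega

lemma exists_strictMono_nat_of_compositionSeries {α : Type*} [Lattice α] [BoundedOrder α]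
    [IsModularLattice α] (s : RelSeries {p : α × α | p.1 ⋖ p.2}) (h0 : s.head = ⊥)
    (h1 : s.last = ⊤) : ∃ r : α → ℕ, StrictMono r := by
  have key : ∀ n (hn : n < s.length + 1), ∃ r : α → ℕ, StrictMonoOn r (Set.Iic (s ⟨n, hn⟩)) := by
    intro n
    induction n with
    | zero =>
      intro hn
      refine ⟨fun _ => 0, fun p hp q hq hpq => ?_⟩
      have hq' : q ≤ ⊥ := h0 ▸ hq
      exact absurd (hpq.trans_le hq') not_lt_bot
    | succ n ih =>
      intro hn
      exact exists_strictMonoOn_Iic_of_covBy (s.step ⟨n, by omega⟩) (ih (by omega))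
  obtain ⟨r, hr⟩ := key s.length (by omega)
  have : s ⟨s.length, by omega⟩ = ⊤ := h1
  rw [this, Set.Iic_top, strictMonoOn_univ] at hr
  exact ⟨r, hr⟩

variable {C : Type u} [Category.{v} C]

/-- The poset of subobjects of `X` admits a strictly monotone rank function with top value `n`. -/
def HasRank (X : C) (n : ℕ) : Prop := ∃ r : Subobject X → ℕ, StrictMono r ∧ r ⊤ = n

lemma HasRank.of_mono {A X : C} (i : A ⟶ X) [Mono i] (hi : ¬ IsIso i) {n : ℕ}
    (h : HasRank X n) : ∃ m < n, HasRank A m := by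
  obtain ⟨r, hr, rfl⟩ := h
  have hmap : StrictMono (Subobject.map i).obj :=
    (Subobject.map i).monotone.strictMono_of_injective (Subobject.map_obj_injective i)
  refine ⟨_, hr (lt_top_iff_ne_top.2 fun h => hi ?_), fun p => r ((Subobject.map i).obj p),
    hr.comp hmap, rfl⟩
  rw [Subobject.map_top] at h
  exact (Subobject.isIso_iff_mk_eq_top i).2 h

variable [Abelian C]

/-- The join is contained in the image of P ⊞ Q → X; a generalized element of that image lifts to
the biproduct after an epi refinement. -/
lemma Subobject.exists_add_of_le_sup {X A : C} {P Q : Subobject X} (a : A ⟶ X)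
    (ha : (P ⊔ Q).Factors a) : ∃ (A' : C) (π : A' ⟶ A) (_ : Epi π) (b c : A' ⟶ X),
      P.Factors b ∧ Q.Factors c ∧ π ≫ a = b + c := by
  have hle : P ⊔ Q ≤ imageSubobject (biprod.desc P.arrow Q.arrow) := by
    apply sup_le
    · exact Subobject.le_of_comm (biprod.inl ≫ factorThruImageSubobject _) (by simp)
    · exact Subobject.le_of_comm (biprod.inr ≫ factorThruImageSubobject _) (by simp)
  have ha' := Subobject.factors_of_le a hle ha
  obtain ⟨A', π, hπ, x, hx⟩ := surjective_up_to_refinements_of_epi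
    (factorThruImageSubobject (biprod.desc P.arrow Q.arrow)) (Subobject.factorThru _ a ha')
  refine ⟨A', π, hπ, x ≫ biprod.fst ≫ P.arrow, x ≫ biprod.snd ≫ Q.arrow, ?_, ?_, ?_⟩
  · rw [← Category.assoc]; exact Subobject.factors_comp_arrow _
  · rw [← Category.assoc]; exact Subobject.factors_comp_arrow _
  · have := hx =≫ (imageSubobject (biprod.desc P.arrow Q.arrow)).arrow
    simp only [Category.assoc, Subobject.factorThru_arrow, imageSubobject_arrow_comp] at this
    rw [this, biprod.desc_eq]
    simp

lemma Subobject.factors_of_epi_comp {X A A' : C} {P : Subobject X} (π : A' ⟶ A) [Epi π]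
    (a : A ⟶ X) (h : P.Factors (π ≫ a)) : P.Factors a := by
  have h0 : a ≫ cokernel.π P.arrow = 0 := by
    rw [← cancel_epi π, ← Category.assoc, ← P.factorThru_arrow _ h, Category.assoc,
      cokernel.condition, comp_zero, comp_zero]
  rw [← Abelian.monoLift_comp P.arrow a h0]
  exact Subobject.factors_comp_arrow _

instance Subobject.isModularLattice (X : C) : IsModularLattice (Subobject X) where
  sup_inf_le_assoc_of_le {P} Q {R} h := by
    have hfac : ((P ⊔ Q) ⊓ R).Factors ((P ⊔ Q) ⊓ R).arrow :=
      Subobject.factors_self _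
    rw [Subobject.inf_factors] at hfac
    -- The elementwise proof: if b + c lies in R and b lies in P ≤ R, then c lies in Q ∩ R.
    obtain ⟨A', π, hπ, b, c, hb, hc, e⟩ := Subobject.exists_add_of_le_sup _ hfac.1
    have hcR : R.Factors c := Subobject.factors_right_of_factors_add b c
      (e ▸ Subobject.factors_of_factors_right π hfac.2) (Subobject.factors_of_le b h hb)
    have hbc : (P ⊔ Q ⊓ R).Factors (b + c) :=
      Subobject.factors_add _ _ (Subobject.factors_of_le _ le_sup_left hb)
        (Subobject.factors_of_le _ le_sup_right ((Subobject.inf_factors _).2 ⟨hc, hcR⟩))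
    exact Subobject.le_of_factors (Subobject.factors_of_epi_comp π _ (e ▸ hbc))

lemma HasRank.op {X : C} {n : ℕ} (h : HasRank X n) : HasRank (Opposite.op X) n := by
  obtain ⟨r, hr, rfl⟩ := h
  let e := Abelian.subobjectIsoSubobjectOp X
  have hbot : ∀ p, r ⊥ ≤ r p := fun p => hr.monotone bot_le
  have htop : ∀ p, r p ≤ r ⊤ := fun p => hr.monotone le_top
  -- The subtraction never truncates, and adding `r ⊥` keeps the top value equal to `r ⊤`.
  refine ⟨fun p => r ⊤ - r (e.symm (OrderDual.toDual p)) + r ⊥, fun p q hpq => ?_, ?_⟩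
  · have : e.symm (OrderDual.toDual q) < e.symm (OrderDual.toDual p) :=
      e.symm.strictMono (OrderDual.toDual_lt_toDual.2 hpq)
    have := hr this
    have := htop (e.symm (OrderDual.toDual p))
    dsimp only
    omega
  · have : e.symm (OrderDual.toDual ⊤) = ⊥ := e.symm.map_bot
    dsimp only
    rw [this]
    have := hbot ⊤
    omega

lemma HasRank.unop {X : C} {n : ℕ} (h : HasRank (Opposite.op X) n) : HasRank X n := by
  obtain ⟨r, hr, rfl⟩ := h
  let e := Abelian.subobjectIsoSubobjectOp X
  have hbot : ∀ p, r ⊥ ≤ r p := fun p => hr.monotone bot_le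
  have htop : ∀ p, r p ≤ r ⊤ := fun p => hr.monotone le_top
  refine ⟨fun p => r ⊤ - r (OrderDual.ofDual (e p)) + r ⊥, fun p q hpq => ?_, ?_⟩
  · have : OrderDual.ofDual (e q) < OrderDual.ofDual (e p) :=
      OrderDual.ofDual_lt_ofDual.2 (e.strictMono hpq)
    have := hr this
    have := htop (OrderDual.ofDual (e p))
    dsimp only
    omega
  · have : OrderDual.ofDual (e ⊤) = ⊥ := by rw [e.map_top]; rfl
    dsimp only
    rw [this]
    have := hbot ⊤
    omega

lemma HasRank.of_epi {X Q : C} (p : X ⟶ Q) [Epi p] (hp : ¬ IsIso p) {n : ℕ}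
    (h : HasRank X n) : ∃ m < n, HasRank Q m := by
  obtain ⟨m, hm, h'⟩ := h.op.of_mono p.op (fun h => hp ((isIso_op_iff p).1 h))
  exact ⟨m, hm, h'.unop⟩

variable [IsLengthCategory C]

lemma exists_hasRank (X : C) : ∃ n, HasRank X n := by
  obtain ⟨s, h0, h1⟩ := IsLengthCategory.exists_compositionSeries X
  obtain ⟨r, hr⟩ := exists_strictMono_nat_of_compositionSeries s h0 h1
  exact ⟨_, r, hr, rfl⟩

open Classical in
/-- The length of an object. -/
noncomputable def len (X : C) : ℕ := Nat.find (exists_hasRank X)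

lemma hasRank_len (X : C) : HasRank X (len X) := by
  classical exact Nat.find_spec (exists_hasRank X)

lemma len_le_of_hasRank {X : C} {n : ℕ} (h : HasRank X n) : len X ≤ n := by
  classical exact Nat.find_min' (exists_hasRank X) h

lemma len_lt_of_mono {A X : C} (i : A ⟶ X) [Mono i] (hi : ¬ IsIso i) : len A < len X := by
  obtain ⟨m, hm, h⟩ := (hasRank_len X).of_mono i hi
  exact (len_le_of_hasRank h).trans_lt hm

lemma len_lt_of_epi {X Q : C} (p : X ⟶ Q) [Epi p] (hp : ¬ IsIso p) : len Q < len X := by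
  obtain ⟨m, hm, h⟩ := (hasRank_len X).of_epi p hp
  exact (len_le_of_hasRank h).trans_lt hm

lemma len_le_of_iso {X Y : C} (e : X ≅ Y) : len X ≤ len Y := by
  obtain ⟨r, hr, h⟩ := hasRank_len Y
  refine len_le_of_hasRank ⟨fun p => r ((Subobject.map e.hom).obj p), hr.comp
    ((Subobject.map e.hom).monotone.strictMono_of_injective
      (Subobject.map_obj_injective e.hom)), ?_⟩
  dsimp only
  rw [← h, Subobject.map_top, Subobject.mk_eq_top_of_isIso]

lemma len_le_of_mono {A X : C} (i : A ⟶ X) [Mono i] : len A ≤ len X := by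
  by_cases h : IsIso i
  · exact len_le_of_iso (asIso i)
  · exact (len_lt_of_mono i h).le

lemma len_le_of_epi {X Q : C} (p : X ⟶ Q) [Epi p] : len Q ≤ len X := by
  by_cases h : IsIso p
  · exact len_le_of_iso (asIso p).symm
  · exact (len_lt_of_epi p h).le

lemma len_kernel_lt {X Y : C} {f : X ⟶ Y} (hf : f ≠ 0) : len (kernel f) < len X :=
  len_lt_of_mono (kernel.ι f) fun _ => hf <| by
    rw [← cancel_epi (kernel.ι f), kernel.condition, comp_zero]

lemma len_cokernel_lt {X Y : C} {f : X ⟶ Y} (hf : f ≠ 0) : len (cokernel f) < len Y :=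
  len_lt_of_epi (cokernel.π f) fun _ => hf <| by
    rw [← cancel_mono (cokernel.π f), cokernel.condition, zero_comp]

/-- An object of maximal length among those of length at most `n` with a given property. -/
lemma exists_max_len {P : C → Prop} (n : ℕ) (hn : ∀ X, P X → len X ≤ n) (h : ∃ X, P X) :
    ∃ X, P X ∧ ∀ Y, P Y → len Y ≤ len X := by
  obtain ⟨X₀, h₀⟩ := h
  have hfin : {m | ∃ X, P X ∧ len X = m}.Finite :=
    (Set.finite_Iic n).subset (by rintro _ ⟨X, hX, rfl⟩; exact hn X hX)
  obtain ⟨m, ⟨X, hX, rfl⟩, hm⟩ := hfin.exists_maximal ⟨_, X₀, h₀, rfl⟩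
  exact ⟨X, hX, fun Y hY => (le_total (len X) (len Y)).elim (hm ⟨Y, hY, rfl⟩) id⟩

end Length

/-! ### Torsion pairs and joins of torsion classes -/

section TorsionPairs

variable {C : Type u} [Category.{v} C] [Abelian C]

lemma shortExact_cokernel {A X : C} (i : A ⟶ X) [Mono i] :
    (ShortComplex.mk i (cokernel.π i) (cokernel.condition i)).ShortExact :=
  ShortComplex.ShortExact.mk' (ShortComplex.exact_of_g_is_cokernel _ (cokernelIsCokernel i))
    inferInstance inferInstance

lemma shortExact_kernel {X Q : C} (p : X ⟶ Q) [Epi p] :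
    (ShortComplex.mk (kernel.ι p) p (kernel.condition p)).ShortExact :=
  ShortComplex.ShortExact.mk' (ShortComplex.exact_of_f_is_kernel _ (kernelIsKernel p))
    inferInstance inferInstance

lemma shortExact_pullback {A X Q I : C} {i : A ⟶ X} {p : X ⟶ Q} {w : i ≫ p = 0}
    (hS : (ShortComplex.mk i p w).ShortExact) (j : I ⟶ Q) :
    (ShortComplex.mk (pullback.lift i 0 (by rw [w, zero_comp])) (pullback.snd p j)
      (pullback.lift_snd _ _ _)).ShortExact := by
  have : Mono i := hS.mono_f
  have : Epi p := hS.epi_g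
  have hm : Mono (pullback.lift i (0 : A ⟶ I) (by rw [w, zero_comp]) : A ⟶ pullback p j) :=
    mono_of_mono_fac (pullback.lift_fst _ _ _)
  refine ShortComplex.ShortExact.mk' ?_ hm inferInstance
  refine ShortComplex.exact_of_f_is_kernel _ (KernelFork.IsLimit.ofι' _ _ fun {B} k hk => ?_)
  dsimp only at k hk ⊢
  have hk' : (k ≫ pullback.fst p j) ≫ p = 0 := by
    rw [Category.assoc, pullback.condition, ← Category.assoc, hk, zero_comp]
  refine ⟨hS.exact.lift _ hk', ?_⟩
  apply pullback.hom_ext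
  · rw [Category.assoc, pullback.lift_fst]
    exact hS.exact.lift_f _ hk'
  · rw [Category.assoc, pullback.lift_snd, comp_zero, hk]

lemma shortExact_pushout {A X Q B : C} {i : A ⟶ X} {p : X ⟶ Q} {w : i ≫ p = 0}
    (hS : (ShortComplex.mk i p w).ShortExact) (g : A ⟶ B) :
    (ShortComplex.mk (pushout.inr i g) (pushout.desc p 0 (by rw [w, comp_zero]))
      (pushout.inr_desc _ _ _)).ShortExact := by
  have : Mono i := hS.mono_f
  have : Epi p := hS.epi_g
  have he : Epi (pushout.desc p (0 : B ⟶ Q) (by rw [w, comp_zero]) : pushout i g ⟶ Q) :=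
    epi_of_epi_fac (pushout.inl_desc _ _ _)
  refine ShortComplex.ShortExact.mk' ?_ inferInstance he
  refine ShortComplex.exact_of_g_is_cokernel _ (CokernelCofork.IsColimit.ofπ' _ _ fun {Z} k hk => ?_)
  dsimp only at k hk ⊢
  have hk' : i ≫ pushout.inl i g ≫ k = 0 := by
    rw [← Category.assoc, pushout.condition, Category.assoc, hk, comp_zero]
  refine ⟨hS.exact.desc _ hk', ?_⟩
  apply pushout.hom_ext
  · rw [← Category.assoc, pushout.inl_desc]
    exact hS.exact.g_desc _ hk'
  · rw [← Category.assoc, pushout.inr_desc, zero_comp, hk]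

lemma not_isIso_of_comp_eq_zero {X Y Z : C} {f : X ⟶ Y} {g : Y ⟶ Z} (h : f ≫ g = 0) (hg : g ≠ 0) :
    ¬ IsIso f := fun _ => hg (by rw [← cancel_epi f, h, comp_zero])

lemma image_ι_ne_zero {X Y : C} {f : X ⟶ Y} (hf : f ≠ 0) : image.ι f ≠ 0 := fun h =>
  hf (by rw [← image.fac f, h, comp_zero])

lemma not_isZero_image {X Y : C} {f : X ⟶ Y} (hf : f ≠ 0) : ¬ IsZero (image f) := fun h =>
  image_ι_ne_zero hf (h.eq_of_src _ _)

lemma id_ne_zero_of_not_isZero {X : C} (h : ¬ IsZero X) : 𝟙 X ≠ 0 := fun h' =>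
  h ((IsZero.iff_id_eq_zero X).2 h')

lemma mono_ne_zero {X Y : C} (f : X ⟶ Y) [Mono f] (h : ¬ IsZero X) : f ≠ 0 := fun h' =>
  h (IsZero.of_mono_eq_zero f h')

lemma epi_ne_zero {X Y : C} (f : X ⟶ Y) [Epi f] (h : ¬ IsZero Y) : f ≠ 0 := fun h' =>
  h (IsZero.of_epi_eq_zero f h')

namespace CategoryTheory.ObjectProperty

variable (P : ObjectProperty C)

lemma prop_of_mono_of_cokernel [P.IsClosedUnderExtensions] {A X : C} (i : A ⟶ X) [Mono i]
    (hA : P A) (hc : P (cokernel i)) : P X :=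
  P.prop_X₂_of_shortExact (shortExact_cokernel i) hA hc

lemma isClosedUnderIsomorphisms_of_extensions [P.IsClosedUnderExtensions] [P.ContainsZero] :
    P.IsClosedUnderIsomorphisms where
  of_iso {X Y} e hX := by
    obtain ⟨Z, hZ, hPZ⟩ := P.exists_prop_of_containsZero
    refine P.prop_X₂_of_shortExact (S := ShortComplex.mk e.hom (0 : Y ⟶ Z) comp_zero) ?_ hX hPZ
    exact ShortComplex.ShortExact.mk' ((ShortComplex.exact_iff_epi _ rfl).2 inferInstance)
      inferInstance ⟨fun _ _ _ => hZ.eq_of_src _ _⟩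

instance : P.rightOrthogonal.IsClosedUnderSubobjects where
  prop_of_mono i _ h Z g hZ := by
    rw [← cancel_mono i, zero_comp]
    exact h _ hZ

instance : P.leftOrthogonal.IsClosedUnderQuotients where
  prop_of_epi p _ h Z g hZ := by
    rw [← cancel_epi p, comp_zero]
    exact h _ hZ

instance : P.rightOrthogonal.IsClosedUnderExtensions where
  prop_X₂_of_shortExact {S} hS h₁ h₃ Z g hZ := by
    have := hS.mono_f
    rw [← hS.exact.lift_f g (h₃ _ hZ), h₁ (hS.exact.lift g (h₃ _ hZ)) hZ, zero_comp]

instance : P.leftOrthogonal.IsClosedUnderExtensions where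
  prop_X₂_of_shortExact {S} hS h₁ h₃ Z g hZ := by
    have := hS.epi_g
    rw [← hS.exact.g_desc g (h₁ _ hZ), h₃ (hS.exact.desc g (h₁ _ hZ)) hZ, comp_zero]

end CategoryTheory.ObjectProperty

instance Tors.isClosedUnderQuotients (T : Tors C) : T.1.IsClosedUnderQuotients := T.2.quotients

instance Tors.isClosedUnderExtensions (T : Tors C) : T.1.IsClosedUnderExtensions := T.2.extensions

instance Tors.containsZero (T : Tors C) : T.1.ContainsZero := T.2.containsZero

/-- The torsion class of objects without nonzero morphisms to objects of `F`. -/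
def leftTors (F : ObjectProperty C) : Tors C :=
  ⟨F.leftOrthogonal, inferInstance, inferInstance, inferInstance⟩

/-- The torsion class generated by `P`. -/
def genTors (P : ObjectProperty C) : Tors C := leftTors P.rightOrthogonal

lemma le_leftTors_iff {T : Tors C} {F : ObjectProperty C} :
    T ≤ leftTors F ↔ F ≤ T.1.rightOrthogonal :=
  ⟨fun h _ hY _ f hX => h _ hX f hY, fun h _ hX _ f hY => h _ hY f hX⟩

lemma le_genTors (P : ObjectProperty C) : P ≤ (genTors P).1 :=
  fun _ hX _ f hY => hY f hX

lemma rightOrthogonal_antitone {P Q : ObjectProperty C} (h : P ≤ Q) :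
    Q.rightOrthogonal ≤ P.rightOrthogonal := fun _ hY _ f hX => hY f (h _ hX)

lemma rightOrthogonal_genTors (P : ObjectProperty C) :
    (genTors P).1.rightOrthogonal = P.rightOrthogonal :=
  le_antisymm (rightOrthogonal_antitone (le_genTors P)) (le_leftTors_iff.1 le_rfl)

lemma Tors.isZero_of_rightOrthogonal {T : Tors C} {X : C} (h : T.1 X) (h' : T.1.rightOrthogonal X) :
    IsZero X := (IsZero.iff_id_eq_zero X).2 (h' _ h)

/-- Joins of torsion classes are only given as meets of upper bounds; this makes them computable,
since on the torsion-free side they become intersections. -/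
lemma rightOrthogonal_sSup {S : Set (Tors C)} {Y : C} :
    (sSup S).1.rightOrthogonal Y ↔ ∀ T ∈ S, T.1.rightOrthogonal Y := by
  refine ⟨fun h T hT => ?_, fun h => ?_⟩
  · have hle : T ≤ sSup S := le_sSup hT
    exact rightOrthogonal_antitone hle _ h
  have : sSup S ≤ leftTors (fun Z => ∀ T ∈ S, T.1.rightOrthogonal Z) :=
    sSup_le fun T hT => le_leftTors_iff.2 fun Z hZ => hZ T hT
  exact le_leftTors_iff.1 this _ h

lemma rightOrthogonal_sup {U V : Tors C} {Y : C} :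
    (U ⊔ V).1.rightOrthogonal Y ↔ U.1.rightOrthogonal Y ∧ V.1.rightOrthogonal Y := by
  rw [← sSup_pair, rightOrthogonal_sSup]
  simp

variable [IsLengthCategory C]

/-- Take a subobject A in T of maximal length. A nonzero map from T to X/A has its image in T, and
the preimage of that image in X would be a longer subobject in T. -/
lemma Tors.exists_torsionPart (T : Tors C) (X : C) :
    ∃ (A : C) (i : A ⟶ X) (_ : Mono i), T.1 A ∧ T.1.rightOrthogonal (cokernel i) := by
  obtain ⟨A, ⟨hA, i, hi⟩, hmax⟩ := exists_max_len (P := fun A => T.1 A ∧ ∃ i : A ⟶ X, Mono i)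
    (len X) (fun A h => by obtain ⟨_, i, _⟩ := h; exact len_le_of_mono i)
    ⟨_, T.1.prop_zero, 0, inferInstance⟩
  refine ⟨A, i, hi, hA, fun Y f hY => ?_⟩
  by_contra hf
  have hI : T.1 (image f) := T.1.prop_of_epi (factorThruImage f) hY
  have hS := shortExact_pullback (shortExact_cokernel i) (image.ι f)
  have hE : T.1 (pullback (cokernel.π i) (image.ι f)) := T.1.prop_X₂_of_shortExact hS hA hI
  refine absurd (hmax _ ⟨hE, pullback.fst _ _, inferInstance⟩) (not_le.2 ?_)
  have : Mono (pullback.lift i 0 _ : A ⟶ pullback (cokernel.π i) (image.ι f)) := hS.mono_f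
  exact len_lt_of_mono (pullback.lift i 0 _ : A ⟶ pullback (cokernel.π i) (image.ι f))
    (not_isIso_of_comp_eq_zero (pullback.lift_snd _ _ _)
      (epi_ne_zero _ (not_isZero_image hf)))

lemma Tors.prop_iff {T : Tors C} {X : C} :
    T.1 X ↔ ∀ ⦃Y : C⦄ (f : X ⟶ Y), T.1.rightOrthogonal Y → f = 0 := by
  refine ⟨fun h Y f hY => hY f h, fun h => ?_⟩
  obtain ⟨A, i, _, hA, hc⟩ := T.exists_torsionPart X
  have := h (cokernel.π i) hc
  have : Epi i := Preadditive.epi_of_cokernel_zero this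
  exact T.1.prop_of_epi i hA

lemma Tors.le_iff {T T' : Tors C} :
    T ≤ T' ↔ T'.1.rightOrthogonal ≤ T.1.rightOrthogonal :=
  ⟨fun h => rightOrthogonal_antitone h, fun h _ hX => Tors.prop_iff.2 fun _ f hY => h _ hY f hX⟩

lemma genTors_le_iff {P : ObjectProperty C} {T : Tors C} : genTors P ≤ T ↔ P ≤ T.1 :=
  ⟨fun h => (le_genTors P).trans h, fun h => Tors.le_iff.2 <| by
    rw [rightOrthogonal_genTors]; exact rightOrthogonal_antitone h⟩

end TorsionPairs

/-! ### Bricks, completely join-irreducibles and labels -/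

section Bricks

variable {C : Type u} [Category.{v} C] [Abelian C]

/-- A brick is a nonzero object all of whose nonzero endomorphisms are isomorphisms. -/
structure IsBrick (B : C) : Prop where
  not_isZero : ¬ IsZero B
  isIso (f : B ⟶ B) (hf : f ≠ 0) : IsIso f

/-- The third isomorphism theorem, 0 → K/A → X/A → Q → 0; the left map is mono because A is the
pullback of A → X along K → X. -/
lemma shortExact_cokernel_comp {A K X Q : C} (a : A ⟶ K) {k : K ⟶ X} {p : X ⟶ Q} {w : k ≫ p = 0}
    (hS : (ShortComplex.mk k p w).ShortExact) :
    (ShortComplex.mk (cokernel.map a (a ≫ k) (𝟙 A) k (by simp))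
      (cokernel.desc (a ≫ k) p (by rw [Category.assoc, w, comp_zero]))
      (by rw [← cancel_epi (cokernel.π a)]; simp [w])).ShortExact := by
  have : Mono k := hS.mono_f
  have : Epi p := hS.epi_g
  have hpb : IsPullback a (𝟙 A) k (a ≫ k) := by
    refine ⟨⟨by simp⟩, ⟨PullbackCone.IsLimit.mk _ (fun s => s.snd) (fun s => ?_) (fun s => ?_)
      (fun s m h₁ h₂ => ?_)⟩⟩
    · rw [← cancel_mono k, s.condition, Category.assoc]
    · simp
    · simpa using h₂
  have hm : Mono (cokernel.map a (a ≫ k) (𝟙 A) k (by simp)) :=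
    Abelian.mono_cokernel_map_of_isPullback hpb
  have he : Epi (cokernel.desc (a ≫ k) p (by rw [Category.assoc, w, comp_zero])) :=
    epi_of_epi_fac (cokernel.π_desc _ _ _)
  refine ShortComplex.ShortExact.mk' ?_ hm he
  refine ShortComplex.exact_of_g_is_cokernel _ (CokernelCofork.IsColimit.ofπ' _ _ fun {Z} φ hφ => ?_)
  dsimp only at φ hφ ⊢
  have hk : k ≫ cokernel.π (a ≫ k) ≫ φ = 0 := by
    have := cokernel.π a ≫= hφ
    simpa using this
  refine ⟨hS.exact.desc _ hk, ?_⟩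
  rw [← cancel_epi (cokernel.π (a ≫ k)), ← Category.assoc, cokernel.π_desc]
  exact hS.exact.g_desc _ hk

lemma Tors.inf_iff {T T' : Tors C} {X : C} : (T ⊓ T').1 X ↔ T.1 X ∧ T'.1 X := by
  rw [← sInf_pair]
  exact ⟨fun h => ⟨h T (by simp), h T' (by simp)⟩, fun h S hS => by
    rcases hS with rfl | rfl
    exacts [h.1, h.2]⟩

/-- The torsion class generated by an object. -/
def objTors (B : C) : Tors C := genTors (.singleton B)

lemma rightOrthogonal_objTors {B Y : C} :
    (objTors B).1.rightOrthogonal Y ↔ ∀ f : B ⟶ Y, f = 0 := by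
  rw [objTors, rightOrthogonal_genTors]
  refine ⟨fun h f => h f (by simp), fun h X f hX => ?_⟩
  obtain rfl : B = X := by simpa using hX
  exact h f

lemma objTors_self (B : C) : (objTors B).1 B := le_genTors _ _ (by simp)

lemma leftTors_singleton {B X : C} : (leftTors (.singleton B)).1 X ↔ ∀ f : X ⟶ B, f = 0 := by
  refine ⟨fun h f => h f (by simp), fun h Y f hY => ?_⟩
  obtain rfl : B = Y := by simpa using hY
  exact h f

lemma le_leftTors_singleton {B : C} {T : Tors C} :
    T ≤ leftTors (.singleton B) ↔ T.1.rightOrthogonal B := by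
  rw [le_leftTors_iff]
  simp

lemma IsBrick.isIso_of_mono {B I : C} (hB : IsBrick B) (i : I ⟶ B) [Mono i] {f : B ⟶ I}
    (hf : f ≠ 0) : IsIso i := by
  have := hB.isIso (f ≫ i) fun h => hf (by rw [← cancel_mono i, h, zero_comp])
  have : Epi i := epi_of_epi f i
  exact isIso_of_mono_of_epi i

/-- A nonzero image I ⊆ B of an object of T lies in T(B), so B maps nontrivially to I. The composite
B → I → B is then invertible, which forces I = B. -/
lemma IsBrick.rightOrthogonal_of_le_objTors {B : C} (hB : IsBrick B) {T : Tors C}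
    (hT : T ≤ objTors B) (h : ¬ T.1 B) : T.1.rightOrthogonal B := by
  intro X g hX
  by_contra hg
  have hI := T.1.prop_of_epi (factorThruImage g) hX
  obtain ⟨f, hf⟩ : ∃ f : B ⟶ image g, f ≠ 0 := by
    by_contra! h'
    exact not_isZero_image hg (Tors.isZero_of_rightOrthogonal (hT _ hI)
      (rightOrthogonal_objTors.2 h'))
  have := hB.isIso_of_mono (image.ι g) hf
  exact h (T.1.prop_of_epi (image.ι g) hI)

variable [IsLengthCategory C]

lemma isIso_of_epi_endo {X : C} (f : X ⟶ X) [Epi f] : IsIso f := by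
  by_contra h
  exact lt_irrefl _ (len_lt_of_epi f h)

/-- Every nonzero object has a brick that is both a quotient and a subobject. -/
lemma exists_brick {X : C} (hX : ¬ IsZero X) :
    ∃ (B : C) (p : X ⟶ B) (i : B ⟶ X), IsBrick B ∧ Epi p ∧ Mono i := by
  induction hn : len X using Nat.strong_induction_on generalizing X with
  | _ n ih =>
  by_cases hb : IsBrick X
  · exact ⟨X, 𝟙 X, 𝟙 X, hb, inferInstance, inferInstance⟩
  -- The image of f is nonzero, both a quotient and a subobject of X, and strictly shorter.
  obtain ⟨f, hf, hiso⟩ : ∃ f : X ⟶ X, f ≠ 0 ∧ ¬ IsIso f := by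
    by_contra! h
    exact hb ⟨hX, h⟩
  have hι : ¬ IsIso (image.ι f) := fun h => by
    have : Epi f := by rw [← image.fac f]; infer_instance
    exact hiso (isIso_of_epi_endo f)
  obtain ⟨B, p, i, hB, hp, hi⟩ := ih _ (hn ▸ len_lt_of_mono _ hι) (not_isZero_image hf) rfl
  exact ⟨B, factorThruImage f ≫ p, i ≫ image.ι f, hB, epi_comp _ _, mono_comp _ _⟩

/-- Dividing an object of T outside U by its U-torsion part leaves a nonzero object of T ∩ U^⊥. Its
brick is in T as a quotient and in U^⊥ as a subobject. -/
lemma exists_brick_of_not_le {T U : Tors C} (h : ¬ T ≤ U) :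
    ∃ B, IsBrick B ∧ T.1 B ∧ U.1.rightOrthogonal B := by
  obtain ⟨X, hX, hXU⟩ : ∃ X, T.1 X ∧ ¬ U.1 X := by
    by_contra! h'
    exact h h'
  obtain ⟨A, i, _, hA, hc⟩ := U.exists_torsionPart X
  have hne : ¬ IsZero (cokernel i) := fun hz => hXU <| by
    have : Epi i := Preadditive.epi_of_isZero_cokernel i hz
    exact U.1.prop_of_epi i hA
  obtain ⟨B, p, j, hB, _, _⟩ := exists_brick hne
  exact ⟨B, hB, T.1.prop_of_epi (cokernel.π i ≫ p) hX, U.1.rightOrthogonal.prop_of_mono j hc⟩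

/-- The heart of an interval of torsion classes is generated by its bricks under extensions. -/
lemma prop_of_forall_brick {T U : Tors C} (hUT : U ≤ T) (P : ObjectProperty C)
    [P.IsClosedUnderExtensions] [P.ContainsZero]
    (hP : ∀ B, IsBrick B → T.1 B → U.1.rightOrthogonal B → P B) {X : C} (hT : T.1 X)
    (hU : U.1.rightOrthogonal X) : P X := by
  have := P.isClosedUnderIsomorphisms_of_extensions
  induction hn : len X using Nat.strong_induction_on generalizing X with
  | _ n ih =>
  by_cases hX : IsZero X
  · exact P.prop_of_isZero hX
  obtain ⟨B, p, i, hB, _, _⟩ := exists_brick hX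
  have hBT := T.1.prop_of_epi p hT
  have hBU := U.1.rightOrthogonal.prop_of_mono i hU
  -- If the T-torsion part A of ker p vanishes, B ↪ X cannot factor through ker p, so p splits; ker
  -- p is then a quotient of X, hence zero, and X ≅ B. Otherwise A and X/A are shorter objects of
  -- the heart, X/A being an extension of B by (ker p)/A.
  obtain ⟨A, a, _, hA, hc⟩ := T.exists_torsionPart (kernel p)
  by_cases hAz : IsZero A
  · have hK : T.1.rightOrthogonal (kernel p) :=
      T.1.rightOrthogonal.prop_of_mono_of_cokernel a (ObjectProperty.prop_of_isZero _ hAz) hc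
    have hip : i ≫ p ≠ 0 := fun h => mono_ne_zero i hB.not_isZero <| by
      rw [← kernel.lift_ι p i h, hK (kernel.lift p i h) hBT, zero_comp]
    have := hB.isIso _ hip
    obtain ⟨r, hr⟩ : ∃ r : X ⟶ kernel p, kernel.ι p ≫ r = 𝟙 _ :=
      ⟨kernel.lift p (𝟙 X - p ≫ inv (i ≫ p) ≫ i) (by simp), by
        rw [← cancel_mono (kernel.ι p)]
        simp⟩
    have : Epi r := epi_of_epi_fac hr
    have hKz := Tors.isZero_of_rightOrthogonal (T.1.prop_of_epi r hT) hK
    have : Mono p := Preadditive.mono_of_isZero_kernel p hKz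
    have : IsIso p := isIso_of_mono_of_epi p
    exact P.prop_of_iso (asIso p).symm (hP B hB hBT hBU)
  · have hp := epi_ne_zero p hB.not_isZero
    have hj := mono_ne_zero (a ≫ kernel.ι p) hAz
    refine P.prop_of_mono_of_cokernel (a ≫ kernel.ι p) (ih _ ?_ hA ?_ rfl) (ih _ ?_ ?_ ?_ rfl)
    · rw [← hn]
      exact (len_le_of_mono a).trans_lt (len_kernel_lt hp)
    · exact U.1.rightOrthogonal.prop_of_mono (a ≫ kernel.ι p) hU
    · rw [← hn]
      exact len_cokernel_lt hj
    · exact T.1.prop_of_epi (cokernel.π _) hT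
    · exact U.1.rightOrthogonal.prop_X₂_of_shortExact
        (shortExact_cokernel_comp a (shortExact_kernel p)) (rightOrthogonal_antitone hUT _ hc) hBU

lemma objTors_le_iff {B : C} {T : Tors C} : objTors B ≤ T ↔ T.1 B := by
  rw [objTors, genTors_le_iff]
  simp

lemma IsBrick.objTors_inf_leftTors_lt {B : C} (hB : IsBrick B) :
    objTors B ⊓ leftTors (.singleton B) < objTors B := by
  refine lt_of_le_of_ne inf_le_left fun h => ?_
  exact id_ne_zero_of_not_isZero hB.not_isZero
    (leftTors_singleton.1 (objTors_le_iff.1 (inf_eq_left.1 h)) (𝟙 B))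

lemma IsBrick.lowerStar_objTors {B : C} (hB : IsBrick B) :
    lowerStar (objTors B) = objTors B ⊓ leftTors (.singleton B) := by
  apply le_antisymm
  · refine sSup_le fun T hT => le_inf hT.le (le_leftTors_singleton.2 ?_)
    exact hB.rightOrthogonal_of_le_objTors hT.le fun h => hT.not_ge (objTors_le_iff.2 h)
  · exact le_sSup hB.objTors_inf_leftTors_lt

lemma IsBrick.isCompletelyJoinIrreducible {B : C} (hB : IsBrick B) :
    IsCompletelyJoinIrreducible (objTors B) := by
  intro X hX
  by_contra h
  refine (hB.lowerStar_objTors.trans_lt hB.objTors_inf_leftTors_lt).not_ge ?_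
  refine hX.le.trans (sSup_le fun T hT => le_sSup ?_)
  have hle : T ≤ objTors B := hX ▸ le_sSup hT
  exact lt_of_le_of_ne hle fun e => h (e ▸ hT)

lemma IsBrick.isGreatest_kappaSet {B : C} (hB : IsBrick B) :
    IsGreatest (kappaSet (objTors B)) (leftTors (.singleton B)) := by
  refine ⟨hB.lowerStar_objTors.symm, fun T (hT : _ = _) => ?_⟩
  rw [hB.lowerStar_objTors] at hT
  have hTB : ¬ T.1 B := fun h => id_ne_zero_of_not_isZero hB.not_isZero
    (leftTors_singleton.1 (Tors.inf_iff.1 (hT ▸ Tors.inf_iff.2 ⟨objTors_self B, h⟩)).2 (𝟙 B))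
  rw [le_leftTors_singleton]
  obtain ⟨A, i, _, hA, hc⟩ := T.exists_torsionPart B
  by_cases hAz : IsZero A
  · exact T.1.rightOrthogonal.prop_of_mono_of_cokernel i (ObjectProperty.prop_of_isZero _ hAz) hc
  exfalso
  -- A nonzero map B/A → B would give an invertible endomorphism of B killing A ≠ 0. So B/A lies in
  -- T(B) ∩ ⊥B, hence in T, while it is also T-torsion-free.
  have hmem : (objTors B ⊓ leftTors (.singleton B)).1 (cokernel i) := by
    refine Tors.inf_iff.2 ⟨(objTors B).1.prop_of_epi (cokernel.π i) (objTors_self B),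
      leftTors_singleton.2 fun f => ?_⟩
    by_contra hf
    have := hB.isIso (cokernel.π i ≫ f) fun h => hf (by
      rw [← cancel_epi (cokernel.π i), h, comp_zero])
    exact mono_ne_zero i hAz (by
      rw [← cancel_mono (cokernel.π i ≫ f), ← Category.assoc, cokernel.condition, zero_comp,
        zero_comp])
  rw [← hT] at hmem
  have hz := Tors.isZero_of_rightOrthogonal (Tors.inf_iff.1 hmem).2 hc
  have : Epi i := Preadditive.epi_of_isZero_cokernel i hz
  exact hTB (T.1.prop_of_epi i hA)

/-- Choose a brick B in j that is torsion-free for j_*. If T(B) were strictly below j it would lie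
below j_*, making B both torsion and torsion-free. -/
lemma exists_brick_of_isCompletelyJoinIrreducible {j : Tors C}
    (hj : IsCompletelyJoinIrreducible j) : ∃ B, IsBrick B ∧ objTors B = j := by
  have hlt : ¬ j ≤ lowerStar j := fun h =>
    lt_irrefl j (hj _ (h.antisymm (sSup_le fun x hx => le_of_lt hx)))
  obtain ⟨B, hB, hBj, hBl⟩ := exists_brick_of_not_le hlt
  refine ⟨B, hB, by_contra fun hne => hB.not_isZero ?_⟩
  have hle : objTors B ≤ lowerStar j := le_sSup (lt_of_le_of_ne (objTors_le_iff.2 hBj) hne)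
  exact Tors.isZero_of_rightOrthogonal (objTors_le_iff.1 hle) hBl

lemma isGreatest_kappa (j : JIrr (Tors C)) : IsGreatest (kappaSet j.1) (kappa j) := by
  obtain ⟨B, hB, h⟩ := exists_brick_of_isCompletelyJoinIrreducible j.2
  have := hB.isGreatest_kappaSet
  rw [h] at this
  rwa [kappa, this.isLUB.sSup_eq]

lemma mem_jlabel_iff {I : NonemptyInterval (Tors C)} {j : JIrr (Tors C)} {B : C} (hB : IsBrick B)
    (h : objTors B = j.1) : j ∈ jlabel I ↔ heart I B := by
  have hk := hB.isGreatest_kappaSet.isLUB.sSup_eq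
  rw [h] at hk
  change _ ≤ _ ∧ _ ≤ sSup _ ↔ _ ∧ _
  rw [hk, ← h, objTors_le_iff, le_leftTors_singleton]

instance heart_isClosedUnderExtensions (I : NonemptyInterval (Tors C)) :
    (heart I).IsClosedUnderExtensions where
  prop_X₂_of_shortExact hS h₁ h₃ := ⟨I.snd.1.prop_X₂_of_shortExact hS h₁.1 h₃.1,
    I.fst.1.rightOrthogonal.prop_X₂_of_shortExact hS h₁.2 h₃.2⟩

instance heart_containsZero (I : NonemptyInterval (Tors C)) : (heart I).ContainsZero where
  exists_zero := ⟨_, isZero_zero C, I.snd.1.prop_zero, I.fst.1.rightOrthogonal.prop_zero⟩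

lemma jlabel_subset_iff {I J : NonemptyInterval (Tors C)} :
    jlabel I ⊆ jlabel J ↔ heart I ≤ heart J := by
  refine ⟨fun h X hX => ?_, fun h j hj => ?_⟩
  · refine prop_of_forall_brick I.fst_le_snd (heart J) (fun B hB h₁ h₂ => ?_) hX.1 hX.2
    have hj : (⟨objTors B, hB.isCompletelyJoinIrreducible⟩ : JIrr (Tors C)) ∈ jlabel I :=
      (mem_jlabel_iff hB rfl).2 ⟨h₁, h₂⟩
    exact (mem_jlabel_iff hB rfl).1 (h hj)
  · obtain ⟨B, hB, e⟩ := exists_brick_of_isCompletelyJoinIrreducible j.2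
    exact (mem_jlabel_iff hB e).2 (h _ ((mem_jlabel_iff hB e).1 hj))

end Bricks

/-! ### Invariance of the lattice constructions under isomorphism -/

section Transport

/-- Two maps inducing the same preorder on a set have isomorphic images. -/
lemma nonempty_image_orderIso {ι α β : Type*} [PartialOrder α] [PartialOrder β] (f : ι → α)
    (g : ι → β) (S : Set ι) (h : ∀ i j, f i ≤ f j ↔ g i ≤ g j) :
    Nonempty ((f '' S : Set α) ≃o (g '' S : Set β)) := by
  have hfg : ∀ i j, f i = f j ↔ g i = g j := fun i j => by
    rw [le_antisymm_iff, le_antisymm_iff, h, h]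
  choose a ha hfa using fun x : (f '' S : Set α) => x.2
  choose b hb hgb using fun y : (g '' S : Set β) => y.2
  exact ⟨{
    toFun := fun x => ⟨g (a x), a x, ha x, rfl⟩
    invFun := fun y => ⟨f (b y), b y, hb y, rfl⟩
    left_inv := fun x => Subtype.ext (((hfg _ _).2 (hgb _)).trans (hfa x))
    right_inv := fun y => Subtype.ext (((hfg _ _).1 (hfa _)).trans (hgb y))
    map_rel_iff' := fun {x y} => by
      rw [← Subtype.coe_le_coe, ← Subtype.coe_le_coe, ← hfa x, ← hfa y]
      exact (h _ _).symm }⟩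

variable {L : Type*} {L' : Type*} [CompleteLattice L] [CompleteLattice L'] (e : L ≃o L')

lemma map_lowerStar (a : L) : lowerStar (e a) = e (lowerStar a) := by
  rw [lowerStar, lowerStar, e.map_sSup, sSup_eq_iSup]
  apply le_antisymm
  · refine iSup₂_le fun x (hx : x < e a) => ?_
    refine le_iSup₂_of_le (e.symm x) (show _ < _ from ?_) (by simp)
    rwa [← e.lt_iff_lt, e.apply_symm_apply]
  · exact iSup₂_le fun x (hx : x < a) => le_iSup₂_of_le (e x) (e.lt_iff_lt.2 hx) le_rfl

lemma kappaSet_map (j : L) : kappaSet (e j) = e '' kappaSet j := by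
  ext x
  refine ⟨fun (h : _ = _) => ⟨e.symm x, e.injective ?_, by simp⟩, ?_⟩
  · rw [e.map_inf, e.apply_symm_apply, h, map_lowerStar]
  · rintro ⟨x, hx : _ = _, rfl⟩
    change _ = _
    rw [← e.map_inf, hx, map_lowerStar]

lemma IsCompletelyJoinIrreducible.map {j : L} (h : IsCompletelyJoinIrreducible j) :
    IsCompletelyJoinIrreducible (e j) := by
  intro X hX
  have := h (e.symm '' X) (by
    rw [sSup_image, ← e.symm.map_sSup, ← hX, e.symm_apply_apply])
  obtain ⟨x, hx, rfl⟩ := this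
  simpa using hx

lemma kappa_map (j : JIrr L) : kappa ⟨e j.1, j.2.map e⟩ = e (kappa j) := by
  rw [kappa, kappa, kappaSet_map, sSup_image, e.map_sSup]

lemma mem_jlabel_map_iff (I : NonemptyInterval L) (j : JIrr L) :
    (⟨e j.1, j.2.map e⟩ : JIrr L') ∈ jlabel (I.map (e : L →o L')) ↔ j ∈ jlabel I := by
  change e j.1 ≤ e I.snd ∧ e I.fst ≤ _ ↔ _ ∧ _
  rw [kappa_map, e.le_iff_le, e.le_iff_le]

lemma jlabel_map_subset_iff (I J : NonemptyInterval L) :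
    jlabel (I.map (e : L →o L')) ⊆ jlabel (J.map (e : L →o L')) ↔ jlabel I ⊆ jlabel J := by
  refine ⟨fun h j hj => (mem_jlabel_map_iff e J j).1 (h ((mem_jlabel_map_iff e I j).2 hj)),
    fun h j hj => ?_⟩
  obtain ⟨j', rfl⟩ : ∃ j' : JIrr L, (⟨e j'.1, j'.2.map e⟩ : JIrr L') = j :=
    ⟨⟨e.symm j.1, j.2.map e.symm⟩, by ext; simp⟩
  exact (mem_jlabel_map_iff e J j').2 (h ((mem_jlabel_map_iff e I j').1 hj))

lemma exists_map_eq (I : NonemptyInterval L') :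
    ∃ J : NonemptyInterval L, J.map (e : L →o L') = I :=
  ⟨I.map (e.symm : L' →o L), by ext <;> simp⟩

lemma map_mem_wideIntervals_iff (I : NonemptyInterval L) :
    I.map (e : L →o L') ∈ wideIntervals L' ↔ I ∈ wideIntervals L := by
  have : {a' | e I.fst ⋖ a' ∧ a' ≤ e I.snd} = e '' {a' | I.fst ⋖ a' ∧ a' ≤ I.snd} := by
    ext x
    obtain ⟨x, rfl⟩ := e.surjective x
    simp
  change e I.snd = e I.fst ⊔ sSup {a' | e I.fst ⋖ a' ∧ a' ≤ e I.snd} ↔ _ = _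
  rw [this, sSup_image, ← e.map_sSup, ← e.map_sup, e.injective.eq_iff]

lemma map_mem_iceIntervals_iff (I : NonemptyInterval L) :
    I.map (e : L →o L') ∈ iceIntervals L' ↔ I ∈ iceIntervals L := by
  have : {a' | e I.fst ⋖ a'} = e '' {a' | I.fst ⋖ a'} := by
    ext x
    obtain ⟨x, rfl⟩ := e.surjective x
    simp
  change e I.snd ≤ e I.fst ⊔ sSup {a' | e I.fst ⋖ a'} ↔ _ ≤ _
  rw [this, sSup_image, ← e.map_sSup, ← e.map_sup, e.le_iff_le]

end Transport

/-! ### From labels to hearts on an abstract lattice -/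

section Computation

variable {C : Type u} [Category.{v} C] [Abelian C] [IsLengthCategory C]
variable {L : Type w} [CompleteLattice L]

lemma isGreatest_kappa_of_orderIso (e : L ≃o Tors C) (j : JIrr L) :
    IsGreatest (kappaSet j.1) (kappa j) := by
  have := isGreatest_kappa (⟨e j.1, j.2.map e⟩ : JIrr (Tors C))
  rw [kappa_map, kappaSet_map] at this
  refine ⟨(e.injective.mem_set_image).1 this.1, fun x hx => ?_⟩
  exact e.le_iff_le.1 (this.2 ⟨x, hx, rfl⟩)

/-- The poset of labels of a set of intervals is the poset of hearts of the corresponding intervals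
of torsion classes. -/
lemma nonempty_jlabelImage_orderIso (e : L ≃o Tors C) {S : Set (NonemptyInterval L)}
    {S' : Set (NonemptyInterval (Tors C))} (hS : ∀ I, I.map (e : L →o Tors C) ∈ S' ↔ I ∈ S)
    {Q : ObjectProperty C → Prop} (hQ : ∀ P, Q P ↔ ∃ I ∈ S', heart I = P) :
    Nonempty (jlabelImage S ≃o {P : ObjectProperty C // Q P}) := by
  obtain ⟨φ⟩ := nonempty_image_orderIso (jlabel (L := L))
    (fun I => heart (I.map (e : L →o Tors C))) S
    (fun I J => (jlabel_map_subset_iff e I J).symm.trans jlabel_subset_iff)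
  have h : (fun I => heart (I.map (e : L →o Tors C))) '' S = {P | Q P} := by
    ext P
    simp only [Set.mem_image, Set.mem_ofPred_eq, hQ]
    constructor
    · rintro ⟨I, hI, rfl⟩
      exact ⟨_, (hS I).2 hI, rfl⟩
    · rintro ⟨I, hI, rfl⟩
      obtain ⟨J, rfl⟩ := exists_map_eq e I
      exact ⟨J, (hS J).1 hI, rfl⟩
  exact ⟨φ.trans (OrderIso.setCongr _ _ h)⟩

end Computation

/-! ### Covers of a torsion class -/

section Covers

variable {C : Type u} [Category.{v} C] [Abelian C]

lemma shortExact_kernel_image {X Y : C} (f : X ⟶ Y) :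
    (ShortComplex.mk (kernel.ι f) (factorThruImage f)
      (by rw [← cancel_mono (image.ι f)]; simp)).ShortExact := by
  refine ShortComplex.ShortExact.mk' ?_ inferInstance inferInstance
  refine ShortComplex.exact_of_f_is_kernel _ (KernelFork.IsLimit.ofι' _ _ fun {A} k hk => ?_)
  dsimp only at k hk ⊢
  exact ⟨kernel.lift f k (by rw [← image.fac f, ← Category.assoc, hk, zero_comp]), by simp⟩

lemma exists_shortExact_pullback {A X I : C} (i : A ⟶ X) [Mono i] (j : I ⟶ cokernel i) [Mono j] :
    ∃ (E : C) (b : A ⟶ E) (q : E ⟶ I) (m : E ⟶ X) (w : b ≫ q = 0),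
      (ShortComplex.mk b q w).ShortExact ∧ Mono m :=
  ⟨_, _, _, pullback.fst _ _, _, shortExact_pullback (shortExact_cokernel i) j, inferInstance⟩

/-- The torsion-free objects all of whose morphisms to torsion-free objects have torsion-free
cokernels. -/
def Tors.rightWide (U : Tors C) : ObjectProperty C := fun X =>
  U.1.rightOrthogonal X ∧
    ∀ ⦃Y : C⦄ (f : X ⟶ Y), U.1.rightOrthogonal Y → U.1.rightOrthogonal (cokernel f)

instance (U : Tors C) : U.rightWide.ContainsZero where
  exists_zero := ⟨_, isZero_zero C, U.1.rightOrthogonal.prop_zero, fun Y f hY => by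
    obtain rfl : f = 0 := (isZero_zero C).eq_of_src _ _
    exact U.1.rightOrthogonal.prop_of_iso cokernelZeroIsoTarget.symm hY⟩

instance (U : Tors C) : U.rightWide.IsClosedUnderExtensions where
  prop_X₂_of_shortExact {S} hS h₁ h₃ := by
    refine ⟨U.1.rightOrthogonal.prop_X₂_of_shortExact hS h₁.1 h₃.1, fun Y f hY => ?_⟩
    have := hS.epi_g
    have hw : S.f ≫ f ≫ cokernel.π (S.f ≫ f) = 0 := by
      rw [← Category.assoc, cokernel.condition]
    -- The cokernel of f is computed in two stages: first divide by the image of `S.X₁`, then by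
    -- that of `S.X₃`. Only the embedding of coker f into coker f₃ is needed.
    let f₃ : S.X₃ ⟶ cokernel (S.f ≫ f) := hS.exact.desc _ hw
    have hf₃ : S.g ≫ f₃ = f ≫ cokernel.π (S.f ≫ f) := hS.exact.g_desc _ hw
    have h := h₃.2 f₃ (h₁.2 (S.f ≫ f) hY)
    have hr : f₃ ≫ cokernel.desc (S.f ≫ f) (cokernel.π f) (by simp) = 0 := by
      rw [← cancel_epi S.g, ← Category.assoc, hf₃]
      simp
    have hs : f ≫ cokernel.π (S.f ≫ f) ≫ cokernel.π f₃ = 0 := by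
      rw [← Category.assoc, ← hf₃, Category.assoc, cokernel.condition, comp_zero]
    have hsr : cokernel.desc f (cokernel.π (S.f ≫ f) ≫ cokernel.π f₃) hs ≫
        cokernel.desc f₃ _ hr = 𝟙 _ := by
      rw [← cancel_epi (cokernel.π f)]
      simp
    have := mono_of_mono_fac hsr
    exact U.1.rightOrthogonal.prop_of_mono
      (cokernel.desc f (cokernel.π (S.f ≫ f) ≫ cokernel.π f₃) hs) h

instance (U : Tors C) : U.rightWide.IsClosedUnderIsomorphisms :=
  U.rightWide.isClosedUnderIsomorphisms_of_extensions

lemma Tors.rightWide_of_epi {U : Tors C} {X Q : C} (p : X ⟶ Q) [Epi p] (hX : U.rightWide X)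
    (hQ : U.1.rightOrthogonal Q) : U.rightWide Q := by
  refine ⟨hQ, fun Y f hY => ?_⟩
  have hs : f ≫ cokernel.π (p ≫ f) = 0 := by
    rw [← cancel_epi p, ← Category.assoc, cokernel.condition, comp_zero]
  have hsr : cokernel.desc f (cokernel.π (p ≫ f)) hs ≫
      cokernel.desc (p ≫ f) (cokernel.π f) (by simp) = 𝟙 _ := by
    rw [← cancel_epi (cokernel.π f)]
    simp
  have := mono_of_mono_fac hsr
  exact U.1.rightOrthogonal.prop_of_mono (cokernel.desc f _ hs) (hX.2 (p ≫ f) hY)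

/-- Pushing f out along ker k → X gives an extension of im k by Z, hence a torsion-free object, and
the pushed-out map from X has the same cokernel as f. -/
lemma Tors.rightWide_kernel {U : Tors C} {X Y : C} (k : X ⟶ Y) (hX : U.rightWide X)
    (hY : U.1.rightOrthogonal Y) : U.rightWide (kernel k) := by
  refine ⟨U.1.rightOrthogonal.prop_of_mono (kernel.ι k) hX.1, fun Z f hZ => ?_⟩
  have hP : U.1.rightOrthogonal (pushout (kernel.ι k) f) :=
    U.1.rightOrthogonal.prop_X₂_of_shortExact (shortExact_pushout (shortExact_kernel_image k) f) hZ
      (U.1.rightOrthogonal.prop_of_mono (image.ι k) hY)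
  have h := hX.2 (pushout.inl (kernel.ι k) f) hP
  have hs : f ≫ pushout.inr (kernel.ι k) f ≫ cokernel.π (pushout.inl (kernel.ι k) f) = 0 := by
    rw [← Category.assoc, ← pushout.condition, Category.assoc, cokernel.condition, comp_zero]
  have hr : kernel.ι k ≫ (0 : X ⟶ cokernel f) = f ≫ cokernel.π f := by simp
  have hsr : cokernel.desc f _ hs ≫ cokernel.desc (pushout.inl (kernel.ι k) f)
      (pushout.desc 0 (cokernel.π f) hr) (pushout.inl_desc _ _ _) = 𝟙 _ := by
    rw [← cancel_epi (cokernel.π f), cokernel.π_desc_assoc, Category.assoc, cokernel.π_desc,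
      pushout.inr_desc, Category.comp_id]
  have := mono_of_mono_fac hsr
  exact U.1.rightOrthogonal.prop_of_mono (cokernel.desc f _ hs) h

/-- Every nonzero morphism from `S` to a torsion-free object is a monomorphism. -/
def Tors.MonoInto (U : Tors C) (S : C) : Prop :=
  ∀ ⦃Y : C⦄ (k : S ⟶ Y), U.1.rightOrthogonal Y → k ≠ 0 → Mono k

lemma Tors.exists_ne_zero_of_le_sup {U T : Tors C} {S X : C} (hT : T ≤ U ⊔ objTors S) (hX : T.1 X)
    (hXU : U.1.rightOrthogonal X) (hXz : ¬ IsZero X) : ∃ k : S ⟶ X, k ≠ 0 := by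
  by_contra! h
  exact hXz (Tors.isZero_of_rightOrthogonal (hT _ hX)
    (rightOrthogonal_sup.2 ⟨hXU, rightOrthogonal_objTors.2 h⟩))

variable [IsLengthCategory C]

/-- If U < T < U ∨ T(S), a nonzero X in T ∩ U^⊥ contains a copy of S, and X/S is again in T ∩ U^⊥.
Repeating, the process stops at an object isomorphic to S, so S lies in T. -/
lemma Tors.covBy_sup_objTors {U : Tors C} {S : C} (hS : U.rightWide S) (hSz : ¬ IsZero S)
    (hmono : U.MonoInto S) : U ⋖ U ⊔ objTors S := by
  refine ⟨lt_of_le_of_ne le_sup_left fun h => hSz ?_, fun T hUT hT => ?_⟩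
  · refine Tors.isZero_of_rightOrthogonal (T := U) ?_ hS.1
    rw [h]
    exact (le_sup_right : objTors S ≤ U ⊔ objTors S) _ (objTors_self S)
  have key : ∀ n (X : C), len X = n → T.1 X → U.1.rightOrthogonal X → ¬ IsZero X → T.1 S := by
    intro n
    induction n using Nat.strong_induction_on with
    | _ n ih =>
    intro X hn hX hXU hXz
    obtain ⟨k, hk⟩ := Tors.exists_ne_zero_of_le_sup hT.le hX hXU hXz
    have := hmono k hXU hk
    by_cases hz : IsZero (cokernel k)
    · have : Epi k := Preadditive.epi_of_isZero_cokernel k hz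
      have : IsIso k := isIso_of_mono_of_epi k
      exact T.1.prop_of_iso (asIso k).symm hX
    · exact ih _ (hn ▸ len_cokernel_lt hk) _ rfl (T.1.prop_of_epi (cokernel.π k) hX)
        (hS.2 k hXU) hz
  obtain ⟨B, hB, hBT, hBU⟩ := exists_brick_of_not_le hUT.not_ge
  exact hT.not_ge (sup_le hUT.le (objTors_le_iff.2 (key _ B rfl hBT hBU hB.not_isZero)))

/-- A class of objects of `U.rightWide` closed under torsion-free quotients and kernels is contained
in a join of covers of `U`. -/
lemma Tors.le_sup_covers {U : Tors C} {D : ObjectProperty C} (hD : D ≤ U.rightWide)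
    (hker : ∀ ⦃X Y : C⦄ (k : X ⟶ Y), D X → U.1.rightOrthogonal Y → D (kernel k))
    (hquot : ∀ ⦃X Q : C⦄ (p : X ⟶ Q) [Epi p], D X → U.1.rightOrthogonal Q → D Q) :
    D ≤ (U ⊔ sSup {V | U ⋖ V ∧ V ≤ U ⊔ genTors D}).1 := by
  -- Passing to kernels of nonzero non-mono maps into U^⊥ ends at a subobject S with U ∨ T(S) a
  -- cover of U; X is then filtered by such S.
  have hsimple : ∀ n (X : C), len X = n → D X → ¬ IsZero X →
      ∃ (S : C) (i : S ⟶ X), Mono i ∧ D S ∧ ¬ IsZero S ∧ U.MonoInto S := by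
    intro n
    induction n using Nat.strong_induction_on with
    | _ n ih =>
    intro X hn hX hXz
    by_cases hm : U.MonoInto X
    · exact ⟨X, 𝟙 X, inferInstance, hX, hXz, hm⟩
    obtain ⟨Y, k, hY, hk, hkm⟩ : ∃ (Y : C) (k : X ⟶ Y), U.1.rightOrthogonal Y ∧ k ≠ 0 ∧ ¬ Mono k := by
      simpa [Tors.MonoInto] using hm
    obtain ⟨S, i, _, h⟩ := ih _ (hn ▸ len_kernel_lt hk) _ rfl (hker k hX hY)
      fun hz => hkm (Preadditive.mono_of_isZero_kernel k hz)
    exact ⟨S, i ≫ kernel.ι k, mono_comp _ _, h⟩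
  intro X hX
  induction hn : len X using Nat.strong_induction_on generalizing X with
  | _ n ih =>
  by_cases hXz : IsZero X
  · exact ObjectProperty.prop_of_isZero _ hXz
  obtain ⟨S, i, _, hS, hSz, hm⟩ := hsimple _ X rfl hX hXz
  have hV : U ⊔ objTors S ≤ U ⊔ sSup {V | U ⋖ V ∧ V ≤ U ⊔ genTors D} := by
    refine le_sup_of_le_right (le_sSup ⟨Tors.covBy_sup_objTors (hD _ hS) hSz hm, ?_⟩)
    exact sup_le_sup_left (objTors_le_iff.2 (le_genTors D _ hS)) U
  refine ObjectProperty.prop_of_mono_of_cokernel _ i ?_ (ih _ ?_ _ ?_ rfl)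
  · exact hV _ ((le_sup_right : objTors S ≤ U ⊔ objTors S) _ (objTors_self S))
  · exact hn ▸ len_cokernel_lt (mono_ne_zero i hSz)
  · exact hquot (cokernel.π i) hX ((hD _ hS).2 i (hD _ hX).1)

/-- A torsion class covering `U` is generated over `U` by an object of `U.rightWide`. -/
lemma Tors.exists_rightWide_of_covBy {U V : Tors C} (h : U ⋖ V) :
    ∃ B, U.rightWide B ∧ V.1 B ∧ ¬ IsZero B ∧ U.MonoInto B ∧ V = U ⊔ objTors B := by
  obtain ⟨B, hB, hBV, hBU⟩ := exists_brick_of_not_le h.lt.not_ge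
  -- V ∩ ⊥B lies between U and V and misses B, so it equals U.
  have hzero : ∀ X, V.1 X → (∀ f : X ⟶ B, f = 0) → U.1 X := by
    intro X hX hf
    have hUB : U ≤ V ⊓ leftTors (.singleton B) := le_inf h.le (le_leftTors_singleton.2 hBU)
    rcases h.eq_or_eq hUB inf_le_left with e | e
    · rw [← e]
      exact Tors.inf_iff.2 ⟨hX, leftTors_singleton.2 hf⟩
    · exact absurd (leftTors_singleton.1 (inf_eq_left.1 e _ hBV) (𝟙 B))
        (id_ne_zero_of_not_isZero hB.not_isZero)
  have hmono : U.MonoInto B := by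
    intro Y k hY hk
    by_contra hkm
    have hU : U.1 (image k) := by
      refine hzero _ (V.1.prop_of_epi (factorThruImage k) hBV) fun f => ?_
      by_contra hf
      have := hB.isIso (factorThruImage k ≫ f) fun h => hf (by
        rw [← cancel_epi (factorThruImage k), h, comp_zero])
      have : Mono (factorThruImage k) := mono_of_mono _ f
      exact hkm (by rw [← image.fac k]; infer_instance)
    exact image_ι_ne_zero hk (hY _ hU)
  refine ⟨B, ⟨hBU, fun Y k hY => ?_⟩, hBV, hB.not_isZero, hmono, ?_⟩
  · by_cases hk : k = 0
    · subst hk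
      exact U.1.rightOrthogonal.prop_of_iso cokernelZeroIsoTarget.symm hY
    have := hmono k hY hk
    intro W g hW
    by_contra hg
    have hI : U.1 (image g) := U.1.prop_of_epi (factorThruImage g) hW
    -- E is the preimage in Y of a U-torsion subobject of coker k. Being in V and torsion-free, it
    -- maps nontrivially to B, and the map is nonzero on B; so B splits off E and the torsion
    -- complement must vanish.
    obtain ⟨E, b, q, m, w, hS, _⟩ := exists_shortExact_pullback k (image.ι g)
    have : Mono b := hS.mono_f
    have : Epi q := hS.epi_g
    have hEV : V.1 E := V.1.prop_X₂_of_shortExact hS hBV (h.le _ hI)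
    have hEU : U.1.rightOrthogonal E := U.1.rightOrthogonal.prop_of_mono m hY
    have hb := mono_ne_zero b hB.not_isZero
    have hEz : ¬ IsZero (E) := fun hz => hb (hz.eq_of_tgt _ _)
    obtain ⟨f, hf⟩ : ∃ f : E ⟶ B, f ≠ 0 := by
      by_contra! h'
      exact hEz (Tors.isZero_of_rightOrthogonal (hzero _ hEV h') hEU)
    have hdesc : ∀ {Z : C} (φ : E ⟶ Z),
        U.1.rightOrthogonal Z → b ≫ φ = 0 → φ = 0 := by
      intro Z φ hZ hφ
      have e := hS.exact.g_desc φ hφ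
      have h0 : (hS.exact.desc φ hφ : image g ⟶ Z) = 0 := hZ _ hI
      rw [← e, h0, comp_zero]
    have hbf : b ≫ f ≠ 0 := fun h' => hf (hdesc f hBU h')
    have := hB.isIso _ hbf
    have hid : 𝟙 _ - f ≫ inv (b ≫ f) ≫ b = 0 := hdesc _ hEU (by
      rw [Preadditive.comp_sub, Category.comp_id, ← Category.assoc b f, IsIso.hom_inv_id_assoc,
        sub_self])
    have hsnd : q = 0 := by
      rw [← Category.id_comp q, sub_eq_zero.1 hid]
      simp [w]
    exact not_isZero_image hg (IsZero.of_epi_eq_zero _ hsnd)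
  · rcases h.eq_or_eq (le_sup_left : U ≤ U ⊔ objTors B)
      (sup_le h.le (objTors_le_iff.2 hBV)) with e | e
    · refine absurd (Tors.isZero_of_rightOrthogonal (T := U) ?_ hBU) hB.not_isZero
      rw [← e]
      exact (le_sup_right : objTors B ≤ U ⊔ objTors B) _ (objTors_self B)
    · exact e.symm

lemma Tors.exists_mono_of_sup_covers {U : Tors C} {S : Set (Tors C)} (hS : ∀ V ∈ S, U ⋖ V) {X : C}
    (hX : (U ⊔ sSup S).1 X) (hXU : U.1.rightOrthogonal X) (hXz : ¬ IsZero X) :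
    ∃ (B : C) (b : B ⟶ X), Mono b ∧ ¬ IsZero B ∧ U.rightWide B ∧ U.MonoInto B ∧ ∃ V ∈ S, V.1 B := by
  obtain ⟨V, hV, hVX⟩ : ∃ V ∈ S, ¬ V.1.rightOrthogonal X := by
    by_contra! h
    exact hXz (Tors.isZero_of_rightOrthogonal hX
      (rightOrthogonal_sup.2 ⟨hXU, rightOrthogonal_sSup.2 h⟩))
  obtain ⟨B, hBw, hBV, hBz, hBm, e⟩ := Tors.exists_rightWide_of_covBy (hS V hV)
  rw [e, rightOrthogonal_sup, rightOrthogonal_objTors] at hVX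
  obtain ⟨b, hb⟩ : ∃ b : B ⟶ X, b ≠ 0 := by
    by_contra! h
    exact hVX ⟨hXU, h⟩
  exact ⟨B, b, hBm b hXU hb, hBz, hBw, hBm, V, hV, hBV⟩

lemma Tors.rightWide_of_sup_covers {U : Tors C} {S : Set (Tors C)} (hS : ∀ V ∈ S, U ⋖ V) {X : C}
    (hX : (U ⊔ sSup S).1 X) (hXU : U.1.rightOrthogonal X) : U.rightWide X := by
  induction hn : len X using Nat.strong_induction_on generalizing X with
  | _ n ih =>
  by_cases hXz : IsZero X
  · exact ObjectProperty.prop_of_isZero _ hXz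
  obtain ⟨B, b, _, hBz, hBw, -, -⟩ := Tors.exists_mono_of_sup_covers hS hX hXU hXz
  exact ObjectProperty.prop_of_mono_of_cokernel _ b hBw
    (ih _ (hn ▸ len_cokernel_lt (mono_ne_zero b hBz))
      ((U ⊔ sSup S).1.prop_of_epi (cokernel.π b) hX) (hBw.2 b hXU) rfl)

end Covers

/-! ### Hearts of wide and ICE intervals -/

section WideIntervals

variable {C : Type u} [Category.{v} C] [Abelian C]

lemma isClosedUnderKernels_of_kernel (P : ObjectProperty C) [P.IsClosedUnderIsomorphisms]
    (h : ∀ ⦃X Y : C⦄ (f : X ⟶ Y), P X → P Y → P (kernel f)) : P.IsClosedUnderKernels where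
  kernels_le := by
    rintro _ ⟨f, k, hk, hf⟩
    exact P.prop_of_iso ((kernelIsKernel f).conePointUniqueUpToIso hk) (h f hf.1 hf.2)

lemma isClosedUnderCokernels_of_cokernel (P : ObjectProperty C) [P.IsClosedUnderIsomorphisms]
    (h : ∀ ⦃X Y : C⦄ (f : X ⟶ Y), P X → P Y → P (cokernel f)) : P.IsClosedUnderCokernels where
  cokernels_le := by
    rintro _ ⟨f, k, hk, hf⟩
    exact P.prop_of_iso ((cokernelIsCokernel f).coconePointUniqueUpToIso hk) (h f hf.1 hf.2)

lemma IsWideSubcategory.isICEClosed {P : ObjectProperty C} (hP : IsWideSubcategory P) :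
    IsICEClosed P where
  containsZero := hP.containsZero
  extensions := hP.extensions
  cokernels := hP.cokernels
  images X Y f hX hY := by
    have := hP.containsZero
    have := hP.extensions
    have := hP.kernels
    have := hP.cokernels
    have := P.isClosedUnderIsomorphisms_of_extensions
    exact P.prop_of_iso (Abelian.imageIsoImage f) (P.prop_kernel _ hY (P.prop_cokernel f hX hY))

lemma exists_epi_to_image {A X Y : C} (b : A ⟶ X) (f : X ⟶ Y) (h : f ≫ cokernel.π (b ≫ f) = 0) :
    ∃ e : X ⟶ image (b ≫ f), Epi e ∧ e ≫ image.ι (b ≫ f) = f := by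
  have hd : b ≫ f ≫ cokernel.π (image.ι (b ≫ f)) = 0 := by
    have := factorThruImage (b ≫ f) ≫= cokernel.condition (image.ι (b ≫ f))
    rwa [← Category.assoc, image.fac, Category.assoc, comp_zero] at this
  have h' : f ≫ cokernel.π (image.ι (b ≫ f)) = 0 := by
    rw [← cokernel.π_desc (b ≫ f) (cokernel.π (image.ι (b ≫ f))) (by rwa [Category.assoc]),
      ← Category.assoc, h, zero_comp]
  refine ⟨Abelian.monoLift _ f h', ?_, Abelian.monoLift_comp _ _ _⟩
  have : b ≫ Abelian.monoLift _ f h' = factorThruImage (b ≫ f) := by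
    rw [← cancel_mono (image.ι (b ≫ f)), Category.assoc, Abelian.monoLift_comp, image.fac]
  exact epi_of_epi_fac this

/-- If `b : B ⟶ X` is a monomorphism, then `kernel f` is a quotient of an extension of the kernel of
the morphism induced on `cokernel b` by `B`. -/
lemma prop_kernel_of_prop_kernel {P : ObjectProperty C} [P.IsClosedUnderExtensions]
    [P.IsClosedUnderQuotients] {B X Y Y' : C} (b : B ⟶ X) [Mono b] (f : X ⟶ Y)
    (f' : cokernel b ⟶ Y') (hB : P B) (hK : P (kernel f'))
    (hf : kernel.ι f ≫ cokernel.π b ≫ f' = 0)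
    (h : ∀ ⦃E : C⦄ (x : E ⟶ X), x ≫ cokernel.π b ≫ f' = 0 → ∃ t : E ⟶ B, t ≫ b ≫ f = x ≫ f ∧
      ∀ ⦃K : C⦄ (s : K ⟶ E), s ≫ x ≫ f = 0 → s ≫ t = 0) : P (kernel f) := by
  have hE := P.prop_X₂_of_shortExact
    (shortExact_pullback (shortExact_cokernel b) (kernel.ι f')) hB hK
  dsimp only at hE
  obtain ⟨t, ht, hst⟩ := h (pullback.fst (cokernel.π b) (kernel.ι f')) (by
    rw [← Category.assoc, pullback.condition, Category.assoc, kernel.condition, comp_zero])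
  have hs : kernel.ι f ≫ cokernel.π b = kernel.lift f' (kernel.ι f ≫ cokernel.π b)
      (by rw [Category.assoc, hf]) ≫ kernel.ι f' := by simp
  -- On the preimage E of ker f' in X, the map x - t ≫ b lands in ker f; it retracts E onto ker f
  -- because t vanishes there.
  have hfac : pullback.lift _ _ hs ≫ kernel.lift f (pullback.fst _ _ - t ≫ b)
      (by rw [Preadditive.sub_comp, Category.assoc, ht, sub_self]) = 𝟙 _ := by
    have := hst (pullback.lift _ _ hs) (by rw [pullback.lift_fst_assoc, kernel.condition])
    rw [← cancel_mono (kernel.ι f), Category.assoc, kernel.lift_ι, Preadditive.comp_sub,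
      pullback.lift_fst, ← Category.assoc, this, zero_comp, sub_zero, Category.id_comp]
  have := epi_of_epi_fac hfac
  exact P.prop_of_epi (kernel.lift f (pullback.fst _ _ - t ≫ b) _) hE

lemma wideIntervals_subset_iceIntervals : wideIntervals (Tors C) ⊆ iceIntervals (Tors C) :=
  fun I (hI : I.snd = _) => show I.snd ≤ _ from
    hI.le.trans (sup_le_sup_left (sSup_le_sSup fun _ h => h.1) _)

variable [IsLengthCategory C]

instance (I : NonemptyInterval (Tors C)) : (heart I).IsClosedUnderIsomorphisms :=
  (heart I).isClosedUnderIsomorphisms_of_extensions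

lemma isICEClosed_heart {I : NonemptyInterval (Tors C)} (hI : I ∈ iceIntervals (Tors C)) :
    IsICEClosed (heart I) where
  containsZero := inferInstance
  extensions := inferInstance
  images _ _ f hX hY := ⟨I.snd.1.prop_of_epi (factorThruImage f) hX.1,
    I.fst.1.rightOrthogonal.prop_of_mono (image.ι f) hY.2⟩
  cokernels := isClosedUnderCokernels_of_cokernel _ fun _ _ f hX hY =>
    ⟨I.snd.1.prop_of_epi (cokernel.π f) hY.1,
      (Tors.rightWide_of_sup_covers (S := {V | I.fst ⋖ V}) (fun _ h => h)
        ((show I.snd ≤ _ from hI) _ hX.1) hX.2).2 f hY.2⟩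

/-- Split off a subobject B of X coming from a cover below the upper end. Either f kills B, or f
embeds B in Y and one passes to X/B → Y/B. Asking only that Y be torsion-free, not in the heart,
lets the induction continue with Y/B. -/
lemma prop_kernel_of_mem_wideIntervals {I : NonemptyInterval (Tors C)}
    (hI : I ∈ wideIntervals (Tors C)) {X Y : C} (f : X ⟶ Y) (hX : heart I X)
    (hY : I.fst.1.rightOrthogonal Y) : I.snd.1 (kernel f) := by
  have hI' : I.snd = _ := hI
  induction hn : len X using Nat.strong_induction_on generalizing X Y with
  | _ n ih =>
  by_cases hXz : IsZero X
  · exact ObjectProperty.prop_of_isZero _ (IsZero.of_mono (kernel.ι f) hXz)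
  obtain ⟨B, b, _, hBz, hBw, hBm, V, hV, hBV⟩ := Tors.exists_mono_of_sup_covers
    (S := {V | I.fst ⋖ V ∧ V ≤ I.snd}) (fun _ h => h.1) (hI'.le _ hX.1) hX.2 hXz
  have hc : heart I (cokernel b) := ⟨I.snd.1.prop_of_epi (cokernel.π b) hX.1, hBw.2 b hX.2⟩
  have hlen : len (cokernel b) < n := hn ▸ len_cokernel_lt (mono_ne_zero b hBz)
  have hBT : I.snd.1 B := hV.2 _ hBV
  by_cases hbf : b ≫ f = 0
  · refine prop_kernel_of_prop_kernel b f (cokernel.desc b f hbf) hBT (ih _ hlen _ hc hY rfl)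
      (by simp) fun E x hx => ⟨0, ?_, fun _ _ _ => comp_zero⟩
    rw [zero_comp]
    simpa using hx.symm
  · have := hBm (b ≫ f) hY hbf
    refine prop_kernel_of_prop_kernel b f
      (cokernel.desc b (f ≫ cokernel.π (b ≫ f)) (by rw [← Category.assoc, cokernel.condition])) hBT
      (ih _ hlen _ hc (hBw.2 (b ≫ f) hY) rfl) (by simp) fun E x hx => ?_
    have hx' : (x ≫ f) ≫ cokernel.π (b ≫ f) = 0 := by simpa using hx
    refine ⟨Abelian.monoLift (b ≫ f) (x ≫ f) hx', Abelian.monoLift_comp _ _ _, fun K s hs => ?_⟩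
    rw [← cancel_mono (b ≫ f), Category.assoc, Abelian.monoLift_comp, hs, zero_comp]

lemma isWideSubcategory_heart {I : NonemptyInterval (Tors C)} (hI : I ∈ wideIntervals (Tors C)) :
    IsWideSubcategory (heart I) where
  containsZero := inferInstance
  extensions := inferInstance
  cokernels := (isICEClosed_heart (wideIntervals_subset_iceIntervals hI)).cokernels
  kernels := isClosedUnderKernels_of_kernel _ fun _ _ f hX hY =>
    ⟨prop_kernel_of_mem_wideIntervals hI f hX hY.2,
      I.fst.1.rightOrthogonal.prop_of_mono (kernel.ι f) hX.2⟩

end WideIntervals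

/-! ### Realising ICE-closed and wide subcategories as hearts -/

section ICEClosed

variable {C : Type u} [Category.{v} C] [Abelian C]

lemma le_rightOrthogonal_leftTors (P : ObjectProperty C) : P ≤ (leftTors P).1.rightOrthogonal :=
  le_leftTors_iff.1 le_rfl

lemma exists_ne_zero_of_rightOrthogonal_leftTors {P : ObjectProperty C} {X : C}
    (hX : (leftTors P).1.rightOrthogonal X) (hXz : ¬ IsZero X) :
    ∃ (Y : C) (f : X ⟶ Y), P Y ∧ f ≠ 0 := by
  by_contra! h
  exact hXz (Tors.isZero_of_rightOrthogonal (T := leftTors P) (fun Y f hY => h Y f hY) hX)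

variable [IsLengthCategory C]

/-- An object of the torsion-free class generated by an extension-closed `P` belongs to `P` if the
images of its morphisms to objects of `P` do. -/
lemma prop_of_forall_image {P : ObjectProperty C} [P.IsClosedUnderExtensions] [P.ContainsZero]
    {X : C} (hX : (leftTors P).1.rightOrthogonal X)
    (h : ∀ ⦃Y : C⦄ (f : X ⟶ Y), P Y → ∃ (J : C) (e : X ⟶ J) (m : J ⟶ Y),
      Epi e ∧ Mono m ∧ P J ∧ e ≫ m = f) : P X := by
  have := P.isClosedUnderIsomorphisms_of_extensions
  -- Take the longest quotient Q of X in P. A nonzero map g from ker q to P gives a pushout in P,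
  -- and the image of X there is a quotient in P strictly longer than Q.
  obtain ⟨Q, ⟨hQ, q, _⟩, hmax⟩ := exists_max_len (P := fun Q => P Q ∧ ∃ q : X ⟶ Q, Epi q)
    (len X) (fun Q h => by obtain ⟨_, q, _⟩ := h; exact len_le_of_epi q)
    ⟨_, P.prop_zero, 0, inferInstance⟩
  by_cases hK : IsZero (kernel q)
  · have : Mono q := Preadditive.mono_of_isZero_kernel q hK
    have : IsIso q := isIso_of_mono_of_epi q
    exact P.prop_of_iso (asIso q).symm hQ
  exfalso
  obtain ⟨Y, g, hY, hg⟩ := exists_ne_zero_of_rightOrthogonal_leftTors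
    ((leftTors P).1.rightOrthogonal.prop_of_mono (kernel.ι q) hX) hK
  have hP : P (pushout (kernel.ι q) g) :=
    P.prop_X₂_of_shortExact (shortExact_pushout (shortExact_kernel q) g) hY hQ
  obtain ⟨J, e, m, he, _, hJ, hem⟩ := h (pushout.inl (kernel.ι q) g) hP
  obtain ⟨d, hd⟩ : ∃ d : J ⟶ Q, e ≫ d = q :=
    ⟨m ≫ pushout.desc q 0 (by rw [kernel.condition, comp_zero]), by
      rw [← Category.assoc, hem, pushout.inl_desc]⟩
  have : Epi d := epi_of_epi_fac hd
  refine (hmax J ⟨hJ, e, he⟩).not_gt (len_lt_of_epi d fun _ => hg ?_)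
  have h1 : kernel.ι q ≫ e = 0 := by
    rw [← cancel_mono d, Category.assoc, hd, kernel.condition, zero_comp]
  rw [← cancel_mono (pushout.inr (kernel.ι q) g), ← pushout.condition, ← hem, ← Category.assoc, h1,
    zero_comp, zero_comp]

lemma IsICEClosed.prop_of_epi {P : ObjectProperty C} (hP : IsICEClosed P) {X Q : C}
    (p : X ⟶ Q) [Epi p] (hX : P X) (hQ : (leftTors P).1.rightOrthogonal Q) : P Q := by
  have := hP.containsZero
  have := hP.extensions
  refine prop_of_forall_image hQ fun Y f hY => ?_
  obtain ⟨e, he, hem⟩ := exists_epi_to_image p f (by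
    rw [← cancel_epi p, ← Category.assoc, cokernel.condition, comp_zero])
  exact ⟨_, e, _, he, inferInstance, hP.images _ hX hY, hem⟩

/-- Let E ⊆ X be the preimage of a subobject I of X/A with I in ⊥P. Since I has no map to objects of
P, every map from E to P has the same image as its restriction to A, so E lies in P. Then I → E/A
vanishes as well, so I = 0. -/
lemma IsICEClosed.rightOrthogonal_cokernel_of_mono {P : ObjectProperty C} (hP : IsICEClosed P)
    {A X : C} (i : A ⟶ X) [Mono i] (hA : P A) (hX : (leftTors P).1.rightOrthogonal X) :
    (leftTors P).1.rightOrthogonal (cokernel i) := by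
  have := hP.containsZero
  have := hP.extensions
  have := hP.cokernels
  intro W g hW
  by_contra hg
  have hI : (leftTors P).1 (image g) := (leftTors P).1.prop_of_epi (factorThruImage g) hW
  obtain ⟨E, b, q, m, w, hS, _⟩ := exists_shortExact_pullback i (image.ι g)
  have : Epi q := hS.epi_g
  have hE : P E := by
    refine prop_of_forall_image ((leftTors P).1.rightOrthogonal.prop_of_mono m hX) fun Y f hY => ?_
    have hw : b ≫ f ≫ cokernel.π (b ≫ f) = 0 := by rw [← Category.assoc, cokernel.condition]
    have h0 : (hS.exact.desc _ hw : image g ⟶ cokernel (b ≫ f)) = 0 :=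
      hI _ (P.prop_cokernel _ hA hY)
    obtain ⟨e, he, hem⟩ := exists_epi_to_image b f (by
      rw [← hS.exact.g_desc _ hw, h0, comp_zero])
    exact ⟨_, e, _, he, inferInstance, hP.images _ hA hY, hem⟩
  have h0 : (hS.exact.desc _ (cokernel.condition b) : image g ⟶ cokernel b) = 0 :=
    hI _ (P.prop_cokernel b hA hE)
  have hb : Epi b := Preadditive.epi_of_cokernel_zero (by
    rw [← hS.exact.g_desc _ (cokernel.condition b), h0, comp_zero])
  exact not_isZero_image hg (IsZero.of_epi_eq_zero q (by rw [← cancel_epi b, w, comp_zero]))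

lemma IsICEClosed.le_rightWide {P : ObjectProperty C} (hP : IsICEClosed P) :
    P ≤ (leftTors P).rightWide := by
  intro X hX
  refine ⟨le_rightOrthogonal_leftTors P _ hX, fun Y f hY => ?_⟩
  have hI := hP.prop_of_epi (factorThruImage f) hX
    ((leftTors P).1.rightOrthogonal.prop_of_mono (image.ι f) hY)
  have h := hP.rightOrthogonal_cokernel_of_mono (image.ι f) hI hY
  have e : cokernel f ≅ cokernel (image.ι f) :=
    (cokernelIsoOfEq (image.fac f)).symm ≪≫ cokernelEpiComp _ _
  exact (leftTors P).1.rightOrthogonal.prop_of_iso e.symm h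

/-- An ICE-closed subcategory is the heart of the interval from its left orthogonal to the join of
the latter with the torsion class it generates. -/
lemma IsICEClosed.heart_eq {P : ObjectProperty C} (hP : IsICEClosed P) :
    heart ⟨(leftTors P, leftTors P ⊔ genTors P), le_sup_left⟩ = P := by
  have := hP.containsZero
  have := hP.extensions
  have := P.isClosedUnderIsomorphisms_of_extensions
  have hle : P ≤ (leftTors P ⊔ genTors P).1 := fun X hX =>
    (le_sup_right : genTors P ≤ leftTors P ⊔ genTors P) _ (le_genTors P _ hX)
  refine le_antisymm (fun X hX => ?_) fun X hX => ⟨hle _ hX, le_rightOrthogonal_leftTors P _ hX⟩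
  obtain ⟨hXT, hXU⟩ : (leftTors P ⊔ genTors P).1 X ∧ (leftTors P).1.rightOrthogonal X := hX
  induction hn : len X using Nat.strong_induction_on generalizing X with
  | _ n ih =>
  by_cases hXz : IsZero X
  · exact P.prop_of_isZero hXz
  obtain ⟨Z, f, hZ, hf⟩ : ∃ (Z : C) (f : Z ⟶ X), P Z ∧ f ≠ 0 := by
    by_contra! h
    refine hXz (Tors.isZero_of_rightOrthogonal hXT (rightOrthogonal_sup.2 ⟨hXU, ?_⟩))
    rw [rightOrthogonal_genTors]
    exact fun Z f hZ => h Z f hZ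
  have hI := hP.prop_of_epi (factorThruImage f) hZ
    ((leftTors P).1.rightOrthogonal.prop_of_mono (image.ι f) hXU)
  have hcT := (leftTors P ⊔ genTors P).1.prop_of_epi (cokernel.π (image.ι f)) hXT
  have hcU := hP.rightOrthogonal_cokernel_of_mono (image.ι f) hI hXU
  exact P.prop_of_mono_of_cokernel (image.ι f) hI
    (ih _ (hn ▸ len_cokernel_lt (image_ι_ne_zero hf)) _ hcT hcU rfl)

lemma IsICEClosed.exists_iceInterval {P : ObjectProperty C} (hP : IsICEClosed P) :
    ∃ I ∈ iceIntervals (Tors C), heart I = P := by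
  refine ⟨_, ?_, hP.heart_eq⟩
  change leftTors P ⊔ genTors P ≤ _ ⊔ sSup {V | leftTors P ⋖ V}
  refine sup_le le_sup_left (genTors_le_iff.2 (hP.le_rightWide.trans ?_))
  -- P need not be closed under kernels, so the filtration is run in all of `rightWide`; the covers
  -- obtained may then fail to lie below the upper end.
  refine (Tors.le_sup_covers le_rfl (fun X Y k hX hY => Tors.rightWide_kernel k hX hY)
    (fun X Q p _ hX hQ => Tors.rightWide_of_epi p hX hQ)).trans ?_
  exact (sup_le_sup_left (sSup_le_sSup fun V hV => hV.1) _ :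
    leftTors P ⊔ sSup {V | leftTors P ⋖ V ∧ V ≤ leftTors P ⊔ genTors (leftTors P).rightWide} ≤
      leftTors P ⊔ sSup {V | leftTors P ⋖ V})

lemma IsWideSubcategory.exists_wideInterval {P : ObjectProperty C} (hP : IsWideSubcategory P) :
    ∃ I ∈ wideIntervals (Tors C), heart I = P := by
  have hP' := hP.isICEClosed
  have := hP.containsZero
  have := hP.extensions
  have := hP.kernels
  have := P.isClosedUnderIsomorphisms_of_extensions
  refine ⟨_, ?_, hP'.heart_eq⟩
  change leftTors P ⊔ genTors P =
    leftTors P ⊔ sSup {V | leftTors P ⋖ V ∧ V ≤ leftTors P ⊔ genTors P}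
  refine le_antisymm (sup_le le_sup_left (genTors_le_iff.2 ?_))
    (sup_le le_sup_left (sSup_le fun V hV => hV.2))
  -- Kernel closure allows the filtration to be run inside P itself, which keeps the covers below
  -- the upper end.
  refine Tors.le_sup_covers hP'.le_rightWide (fun X Y k hX hY => ?_)
    (fun X Q p _ hX hQ => hP'.prop_of_epi p hX hQ)
  have hI := hP'.prop_of_epi (factorThruImage k) hX
    ((leftTors P).1.rightOrthogonal.prop_of_mono (image.ι k) hY)
  have e : kernel k ≅ kernel (factorThruImage k) :=
    (kernelIsoOfEq (image.fac k)).symm ≪≫ kernelCompMono _ _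
  exact P.prop_of_iso e.symm (P.prop_kernel _ hX hI)

end ICEClosed

/-! ### The three isomorphisms -/

section Main

lemma nonempty_orderIsos_of_orderIso {C : Type u} [Category.{v} C] [Abelian C] [IsLengthCategory C]
    {L : Type w} [CompleteLattice L] (e : L ≃o Tors C) :
    (∀ j : JIrr L, IsGreatest (kappaSet j.1) (kappa j)) ∧
      Nonempty (jlabelImage (Set.univ : Set (NonemptyInterval L)) ≃o THeart C) ∧
      Nonempty (jlabelImage (wideIntervals L) ≃o Wide C) ∧
      Nonempty (jlabelImage (iceIntervals L) ≃o ICE C) := by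
  refine ⟨isGreatest_kappa_of_orderIso e, ?_, ?_, ?_⟩
  · exact nonempty_jlabelImage_orderIso e (S' := Set.univ) (by simp) (by simp)
  · refine nonempty_jlabelImage_orderIso e (map_mem_wideIntervals_iff e) fun P =>
      ⟨fun h => h.exists_wideInterval, ?_⟩
    rintro ⟨I, hI, rfl⟩
    exact isWideSubcategory_heart hI
  · refine nonempty_jlabelImage_orderIso e (map_mem_iceIntervals_iff e) fun P =>
      ⟨fun h => h.exists_iceInterval, ?_⟩
    rintro ⟨I, hI, rfl⟩
    exact isICEClosed_heart hI

theorem theorem3 (C : Type u) [Category.{v} C] [Abelian C] [IsLengthCategory C] :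
    -- the maxima defining `κ` on `tors C` exist
    (∀ j : JIrr (Tors C), IsGreatest (kappaSet j.1) (kappa j)) ∧
    -- the three isomorphisms of posets
    Nonempty (jlabelImage (Set.univ : Set (NonemptyInterval (Tors C))) ≃o THeart C) ∧
    Nonempty (jlabelImage (wideIntervals (Tors C)) ≃o Wide C) ∧
    Nonempty (jlabelImage (iceIntervals (Tors C)) ≃o ICE C) ∧
    -- they can be computed from any abstract lattice isomorphic to `tors C`
    (∀ (L : Type w) [CompleteLattice L], Nonempty (L ≃o Tors C) →
      (∀ j : JIrr L, IsGreatest (kappaSet j.1) (kappa j)) ∧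
      Nonempty (jlabelImage (Set.univ : Set (NonemptyInterval L)) ≃o THeart C) ∧
      Nonempty (jlabelImage (wideIntervals L) ≃o Wide C) ∧
      Nonempty (jlabelImage (iceIntervals L) ≃o ICE C)) := by
  obtain ⟨h₁, h₂, h₃, h₄⟩ := nonempty_orderIsos_of_orderIso (OrderIso.refl (Tors C))
  exact ⟨h₁, h₂, h₃, h₄, fun L _ ⟨e⟩ => nonempty_orderIsos_of_orderIso e⟩

end Main
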